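/- Let $d\ge 1$ and $\Omega=(0,1)^d$. A $\mathrm{ReLU}^2$ network of depth $L\ge 1$ with layer sizes $N_0=d,N_1,\dots,N_{L-1},N_L=1$ implements the function $f:\mathbb R^d\to\mathbb R$ given by $f_0(x)=x$, $f_\ell=\varrho(A_\ell f_{\ell-1}+b_\ell)$ for $1\le \ell\le L-1$ and $f=A_Lf_{L-1}+b_L$, where $\varrho(t)=\max\{0,t\}^2$ acts componentwise; its width is $\max_{0\le\ell\le L}N_\ell$. Let $\mathcal N^2_{\mathcal D,\mathcal W,\mathcal B}$ be the set of functions $f$ implemented by a $\mathrm{ReLU}^2$ network of depth $\mathcal D$ and width $\mathcal W$ with $|f|\le\mathcal B$ and $\|\nabla f\|_2^2\le\mathcal B$ on $\Omega$. There is a constant $C>0$ depending only on $d$ such that the following holds. Let $c_2\in\mathbb R$, let $u^*\in H^2(\Omega)$ with $\|u^*\|_{H^2(\Omega)}\le c_2$, and let $\epsilon>0$. Then there are $\mathcal D,\mathcal W\in\mathbb N$ and $\mathcal B\in\mathbb R$ with $$\mathcal D\le\lceil\log_2 d\rceil+3,\qquad \mathcal W\le 4d\,\Bigl(\max\Bigl\{1,\Bigl\lceil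 \frac{Cc_2}{\epsilon}-4\Bigr\rceil\Bigr\}\Bigr)^d,$$ and a network function $\bar u\in\mathcal N^2_{\mathcal D,\mathcal W,\mathcal B}$ such that $u^*-\bar u\in H^1(\Omega)$ and $\|u^*-\bar u\|_{H^1(\Omega)}\le\epsilon$. Consequently, for every $w\in L^\infty(\Omega)$, $$\frac{\|w\|_{L^\infty(\Omega)}\vee 1}{2}\inf_{v\in\mathcal N^2_{\mathcal D,\mathcal W,\mathcal B}}\|u^*-v\|_{H^1(\Omega)}^2\le\frac{\|w\|_{L^\infty(\Omega)}\vee 1}{2}\|u^*-\bar u\|_{H^1(\Omega)}^2\le\frac{\|w\|_{L^\infty(\Omega)}\vee 1}{2}\epsilon^2 .$$ -/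

import Mathlib

open MeasureTheory
open scoped ENNReal ContDiff

noncomputable section

namespace DeepRitz

/-! ### Sobolev spaces of order one and two on an open set

Points of `ℝ^d` are functions `Fin d → ℝ` with Lebesgue measure. The norm of `Fin d → ℝ` is never
used: everything is expressed through coordinates and partial derivatives. -/

/-- The open unit cube `(0,1)^d`. -/
def cube (d : ℕ) : Set (Fin d → ℝ) := {x | ∀ i, 0 < x i ∧ x i < 1}

/-- The classical partial derivative `∂_i f (x)`. -/
def partialDeriv {d : ℕ} (i : Fin d) (f : (Fin d → ℝ) → ℝ) (x : Fin d → ℝ) : ℝ :=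
  fderiv ℝ f x (Pi.single i 1)

/-- `φ ∈ C_c^∞(Ω)`. -/
structure IsTestFunction {d : ℕ} (Ω : Set (Fin d → ℝ)) (φ : (Fin d → ℝ) → ℝ) : Prop where
  smooth : ContDiff ℝ ∞ φ
  compact : HasCompactSupport φ
  support : tsupport φ ⊆ Ω

/-- `v` is a weak partial derivative `∂_i u` on `Ω`. -/
structure HasWeakPartial {d : ℕ} (Ω : Set (Fin d → ℝ)) (i : Fin d) (u v : (Fin d → ℝ) → ℝ) :
    Prop where
  locInt : LocallyIntegrableOn u Ω
  locInt_deriv : LocallyIntegrableOn v Ω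
  integral_eq : ∀ φ, IsTestFunction Ω φ →
    ∫ x in Ω, u x * partialDeriv i φ x = - ∫ x in Ω, v x * φ x

/-- `u ∈ L²(Ω)`. -/
def MemL2 {d : ℕ} (Ω : Set (Fin d → ℝ)) (u : (Fin d → ℝ) → ℝ) : Prop :=
  MemLp u 2 (volume.restrict Ω)

/-- `u ∈ H¹(Ω)`. -/
def MemH1 {d : ℕ} (Ω : Set (Fin d → ℝ)) (u : (Fin d → ℝ) → ℝ) : Prop :=
  MemL2 Ω u ∧ ∀ i, ∃ v, HasWeakPartial Ω i u v ∧ MemL2 Ω v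

/-- `u ∈ H²(Ω)`: `u ∈ L²(Ω)` has weak partial derivatives, and all of them lie in `H¹(Ω)`. -/
def MemH2 {d : ℕ} (Ω : Set (Fin d → ℝ)) (u : (Fin d → ℝ) → ℝ) : Prop :=
  MemL2 Ω u ∧ ∀ i, ∃ v, HasWeakPartial Ω i u v ∧ MemH1 Ω v

open Classical in
/-- The weak partial derivative `∂_i u` on `Ω` (determined almost everywhere on `Ω`; zero if there
is none). -/
def weakPartial {d : ℕ} (Ω : Set (Fin d → ℝ)) (i : Fin d) (u : (Fin d → ℝ) → ℝ) :
    (Fin d → ℝ) → ℝ :=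
  if h : ∃ v, HasWeakPartial Ω i u v then h.choose else 0

/-- `‖u‖²_{L²(Ω)}`, for `u ∈ L²(Ω)`. -/
def normL2Sq {d : ℕ} (Ω : Set (Fin d → ℝ)) (u : (Fin d → ℝ) → ℝ) : ℝ :=
  ∫ x in Ω, u x ^ 2

/-- `‖u‖_{H¹(Ω)}`, for `u ∈ H¹(Ω)`. -/
def normH1 {d : ℕ} (Ω : Set (Fin d → ℝ)) (u : (Fin d → ℝ) → ℝ) : ℝ :=
  Real.sqrt (normL2Sq Ω u + ∑ i, normL2Sq Ω (weakPartial Ω i u))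

/-- `‖u‖_{H²(Ω)}`, for `u ∈ H²(Ω)`. The pairs `i ≤ j` are the multi-indices of order two. -/
def normH2 {d : ℕ} (Ω : Set (Fin d → ℝ)) (u : (Fin d → ℝ) → ℝ) : ℝ :=
  Real.sqrt (normL2Sq Ω u + ∑ i, normL2Sq Ω (weakPartial Ω i u) +
    ∑ j, ∑ i ∈ Finset.univ.filter (fun i => i ≤ j),
      normL2Sq Ω (weakPartial Ω i (weakPartial Ω j u)))

/-- `‖w‖_{L^∞(Ω)}`, for `w ∈ L^∞(Ω)`. -/
def normLinf {d : ℕ} (Ω : Set (Fin d → ℝ)) (w : (Fin d → ℝ) → ℝ) : ℝ :=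
  (eLpNorm w ∞ (volume.restrict Ω)).toReal

/-! ### ReLU² networks -/

/-- The activation function `ReLU²`: `t²` for `t ≥ 0` and `0` for `t < 0`. -/
def reluSq (t : ℝ) : ℝ := max 0 t ^ 2

/-- Neural networks with `n` inputs and `m` outputs, given by their weights, from the input side:
either a final affine map `x ↦ A x + b`, or a hidden layer `x ↦ ϱ (A x + b)` with `k` units
followed by a network with `k` inputs. -/
inductive Network : ℕ → ℕ → Type
  | output {n m : ℕ} (A : Matrix (Fin m) (Fin n) ℝ) (b : Fin m → ℝ) : Network n m
  | hidden {n k m : ℕ} (A : Matrix (Fin k) (Fin n) ℝ) (b : Fin k → ℝ) (rest : Network k m) :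
      Network n m

/-- The function implemented by a network whose activation function is `ReLU²` in every hidden
layer. -/
def Network.eval : {n m : ℕ} → Network n m → (Fin n → ℝ) → (Fin m → ℝ)
  | _, _, .output A b, x => A.mulVec x + b
  | _, _, .hidden A b rest, x => rest.eval (fun i => reluSq ((A.mulVec x + b) i))

/-- The number `L` of affine maps of a network. -/
def Network.depth : {n m : ℕ} → Network n m → ℕ
  | _, _, .output _ _ => 1
  | _, _, .hidden _ _ rest => rest.depth + 1

/-- The maximum of the layer sizes `N_0, …, N_L`, input and output included. -/
def Network.width : {n m : ℕ} → Network n m → ℕ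
  | n, m, .output _ _ => max n m
  | n, _, .hidden _ _ rest => max n rest.width

/-- The class `𝓝²_{D,W,B}` of real functions implemented by a `ReLU²` network of depth `D` and
width `W`, such that the absolute value of the function and the squared Euclidean norm of its
gradient are bounded by `B` on the unit cube. -/
def reluSqClass (d D W : ℕ) (B : ℝ) : Set ((Fin d → ℝ) → ℝ) :=
  {f | (∃ net : Network d 1, net.depth = D ∧ net.width = W ∧ ∀ x, f x = net.eval x 0) ∧
    ∀ x ∈ cube d, |f x| ≤ B ∧ ∑ i, partialDeriv i f x ^ 2 ≤ B}

/-- The approximation error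
`(‖w‖_{L^∞} ∨ 1) / 2 * inf_{v ∈ 𝓝²_{D,W,B}} ‖u - v‖²_{H¹}` on the unit cube. -/
def approxError (d D W : ℕ) (B : ℝ) (w u : (Fin d → ℝ) → ℝ) : ℝ :=
  max (normLinf (cube d) w) 1 / 2 *
    ⨅ v : reluSqClass d D W B, normH1 (cube d) (fun x => u x - v.1 x) ^ 2

end DeepRitz

end

/-!
The network function is a tensor product quadratic spline. On a mesh of width `1 / n`, the `n + 2`
univariate B-splines that matter on `(0,1)` are combinations of four units `ReLU²` each, so one
hidden layer computes all of them; since `4 a b = (a + b)² - (a - b)²` and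
`t² = ReLU²(t) + ReLU²(-t)`, each further hidden layer multiplies factors in pairs, and
`⌈log₂ d⌉` of them produce all `(n + 2) ^ d` tensor products (`isNet_sum_tensorSpline`). The width
`4 d (n + 2) ^ d` and the depth `⌈log₂ d⌉ + 2` are within the claim, and it remains to approximate
`u` in `H¹` by splines with an error `O(‖u‖_{H²} / n)`.

It is enough to do so for smooth functions: mollifying `u` on a slightly smaller concentric cube and
scaling back to the unit cube uses no values of `u` outside the cube, converges in `H¹`, and keeps
the second derivatives bounded in `L²` (`MemH2.exists_contDiff`).

For a smooth function `f`, the coefficient of each tensor product spline is the mean of `f` over a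
box of side `1 / (2 n)`, centred at the image of the node of the spline under a contraction
`x ↦ (1 - 2 / n) x + 1 / n`. The contraction keeps the boxes inside the cube and costs only
`O(1 / n)` (`quasiInterpolant`). Splines form a partition of unity and reproduce the coordinate
functions, so only the first order Taylor remainder of `f` contributes otherwise. Its mean over a
box near `x` is at most `O(1 / n²)` times a local average of the second derivatives along segments
starting at `x`; by Jensen's inequality and Tonelli's theorem this average is bounded in `L²` by
the second derivatives themselves (`exists_boxMean_bound`). Differentiating a spline costs a
factor `O(n)`, which gives first order convergence of the gradient
(`sq_normH1_quasiInterpolant_sub_le`).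

If the required number of splines per direction is below four, then `‖u‖_{H²} ≤ ε` by the choice of
the constant, and the zero network suffices.
-/

open MeasureTheory
open scoped ENNReal ContDiff

namespace DeepRitz

/-! ### Products and sums computed by `ReLU²` networks -/

theorem hasDerivAt_reluSq (t : ℝ) : HasDerivAt reluSq (2 * max 0 t) t := by
  rcases lt_trichotomy t 0 with h | h | h
  · have : reluSq =ᶠ[nhds t] fun _ => 0 := by
      filter_upwards [Iio_mem_nhds h] with s hs
      simp [reluSq, max_eq_left (le_of_lt (Set.mem_Iio.1 hs))]
    rw [max_eq_left h.le, mul_zero]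
    exact (hasDerivAt_const t (0 : ℝ)).congr_of_eventuallyEq this
  · subst h
    rw [hasDerivAt_iff_isLittleO_nhds_zero]
    have h2 : (fun h : ℝ => h ^ 2) =o[nhds 0] fun h : ℝ => h := by
      simpa using Asymptotics.isLittleO_pow_pow (𝕜 := ℝ) (m := 1) (n := 2) (by norm_num)
    refine Asymptotics.IsBigO.trans_isLittleO (Asymptotics.IsBigO.of_bound 1 ?_) h2
    refine Filter.Eventually.of_forall fun s => ?_
    rcases le_total 0 s with hs | hs
    · simp [reluSq, hs]
    · simp [reluSq, hs]; positivity
  · have : reluSq =ᶠ[nhds t] fun s => s ^ 2 := by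
      filter_upwards [Ioi_mem_nhds h] with s hs
      simp [reluSq, max_eq_right (le_of_lt (Set.mem_Ioi.1 hs))]
    rw [max_eq_right h.le]
    simpa using (hasDerivAt_pow 2 t).congr_of_eventuallyEq this

theorem contDiff_reluSq : ContDiff ℝ 1 reluSq := by
  rw [contDiff_one_iff_deriv]
  refine ⟨fun t => (hasDerivAt_reluSq t).differentiableAt, ?_⟩
  have : deriv reluSq = fun t => 2 * max 0 t := funext fun t => (hasDerivAt_reluSq t).deriv
  rw [this]
  fun_prop

theorem reluSq_add_reluSq_neg (t : ℝ) : reluSq t + reluSq (-t) = t ^ 2 := by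
  rcases le_total 0 t with h | h <;> simp [reluSq, h]

theorem Network.contDiff_eval {n m : ℕ} (net : Network n m) : ContDiff ℝ 1 net.eval := by
  have key : ∀ {n m : ℕ} (A : Matrix (Fin m) (Fin n) ℝ) (b : Fin m → ℝ) (i : Fin m),
      ContDiff ℝ 1 (fun x => (A.mulVec x + b) i) := by
    intro n m A b i
    simp only [Pi.add_apply, Matrix.mulVec, dotProduct]
    fun_prop
  induction net with
  | output A b =>
    rw [contDiff_pi]
    exact fun i => key A b i
  | hidden A b rest ih =>
    have h : ContDiff ℝ 1 (fun x i => reluSq ((A.mulVec x + b) i)) := by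
      rw [contDiff_pi]
      exact fun i => contDiff_reluSq.comp (key A b i)
    exact ih.comp h

/-- `f` is implemented by a `ReLU²` network with `L` affine maps and layers of size at most `W`. -/
def IsNet {n : ℕ} (L W : ℕ) (f : (Fin n → ℝ) → ℝ) : Prop :=
  ∃ net : Network n 1, net.depth = L ∧ net.width ≤ W ∧ ∀ x, f x = net.eval x 0

theorem IsNet.mono {n L W W' : ℕ} {f : (Fin n → ℝ) → ℝ} (h : IsNet L W f) (hW : W ≤ W') :
    IsNet L W' f := by
  obtain ⟨net, h1, h2, h3⟩ := h
  exact ⟨net, h1, h2.trans hW, h3⟩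

theorem IsNet.contDiff {n L W : ℕ} {f : (Fin n → ℝ) → ℝ} (h : IsNet L W f) : ContDiff ℝ 1 f := by
  obtain ⟨net, -, -, h⟩ := h
  rw [funext h]
  exact contDiff_pi.1 net.contDiff_eval 0

theorem isNet_affine {n : ℕ} (a : Fin n → ℝ) (b : ℝ) :
    IsNet 1 (max n 1) (fun x => ∑ l, a l * x l + b) :=
  ⟨.output (fun _ => a) (fun _ => b), rfl, le_rfl, fun _ => rfl⟩

/-- A hidden layer may be put in front of a network; its units are indexed by any finite type. -/
theorem IsNet.hidden {n L W : ℕ} {κ : Type*} [Fintype κ] {f : (Fin (Fintype.card κ) → ℝ) → ℝ}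
    (hf : IsNet L W f) (a : κ → Fin n → ℝ) (b : κ → ℝ) :
    IsNet (L + 1) (max n W) (fun x => f fun i =>
      reluSq (∑ l, a ((Fintype.equivFin κ).symm i) l * x l + b ((Fintype.equivFin κ).symm i))) := by
  obtain ⟨net, h1, h2, h3⟩ := hf
  refine ⟨.hidden (fun i => a ((Fintype.equivFin κ).symm i))
    (fun i => b ((Fintype.equivFin κ).symm i)) net, by simp [Network.depth, h1],
    max_le_max le_rfl h2, fun x => h3 _⟩

/-- The product of two numbers as a linear combination of four values of `ReLU²`. -/
theorem mul_eq_sum_reluSq (a b : ℝ) :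
    a * b = ∑ s : Bool × Bool, cond s.2 1 (-1) / 4 *
      reluSq (cond s.1 1 (-1) * (a + cond s.2 1 (-1) * b)) := by
  have h1 := reluSq_add_reluSq_neg (a + b)
  have h2 := reluSq_add_reluSq_neg (a - b)
  simp only [Fintype.sum_prod_type, Fintype.sum_bool, cond_true, cond_false]
  have e1 : (1 : ℝ) * (a + 1 * b) = a + b := by ring
  have e2 : (1 : ℝ) * (a + -1 * b) = a - b := by ring
  have e3 : (-1 : ℝ) * (a + 1 * b) = -(a + b) := by ring
  have e4 : (-1 : ℝ) * (a + -1 * b) = -(a - b) := by ring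
  rw [e1, e2, e3, e4]
  linear_combination (1 / 4 : ℝ) * h2 - (1 / 4 : ℝ) * h1

/-- A sum of products of `2 ^ k` affine functions is implemented with `k` hidden layers: each
layer multiplies the factors in pairs. -/
theorem isNet_sum_prod (k : ℕ) : ∀ {n : ℕ} {ι : Type} [Fintype ι] (c : ι → ℝ)
    (a : ι → Fin (2 ^ k) → Fin n → ℝ) (b : ι → Fin (2 ^ k) → ℝ),
    IsNet (k + 1) (max (max n 1) (2 * Fintype.card ι * 2 ^ k))
      (fun x => ∑ i, c i * ∏ j, (∑ l, a i j l * x l + b i j)) := by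
  induction k with
  | zero =>
    intro n ι _ c a b
    refine IsNet.mono (W := max n 1) ?_ (le_max_left _ _)
    convert isNet_affine (fun l => ∑ i, c i * a i 0 l) (∑ i, c i * b i 0) using 2 with x
    simp only [Nat.pow_zero, Finset.univ_unique, Fin.default_eq_zero, Finset.prod_singleton,
      Finset.sum_mul, mul_add, Finset.sum_add_distrib, Finset.mul_sum, mul_assoc]
    congr 1
    exact Finset.sum_comm
  | succ k ih =>
    intro n ι _ c a b
    let e : Fin (2 ^ k) × Bool ≃ Fin (2 ^ (k + 1)) :=
      Fintype.equivOfCardEq (by simp [pow_succ])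
    let κ := ι × Fin (2 ^ k) × (Bool × Bool)
    let sg : Bool → ℝ := fun s => cond s 1 (-1)
    let a' : κ → Fin n → ℝ := fun q l => sg q.2.2.1 *
      (a q.1 (e (q.2.1, true)) l + sg q.2.2.2 * a q.1 (e (q.2.1, false)) l)
    let b' : κ → ℝ := fun q => sg q.2.2.1 *
      (b q.1 (e (q.2.1, true)) + sg q.2.2.2 * b q.1 (e (q.2.1, false)))
    let w : ι → Fin (2 ^ k) → κ → ℝ := fun i j q =>
      open Classical in if q.1 = i ∧ q.2.1 = j then sg q.2.2.2 / 4 else 0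
    have h := (ih (n := Fintype.card κ) c
      (fun i j l => w i j ((Fintype.equivFin κ).symm l)) (fun _ _ => 0)).hidden a' b'
    have hcard : Fintype.card κ = 2 * Fintype.card ι * 2 ^ (k + 1) := by
      simp [κ, pow_succ]; ring
    have h2 : 2 * Fintype.card ι * 2 ^ k ≤ 2 * Fintype.card ι * 2 ^ (k + 1) :=
      Nat.mul_le_mul_left _ (Nat.pow_le_pow_right (by norm_num) (Nat.le_succ k))
    have hmono := h.mono (W' := max (max n 1) (2 * Fintype.card ι * 2 ^ (k + 1))) (by omega)
    convert hmono using 2 with x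
    refine Finset.sum_congr rfl fun i _ => ?_
    congr 1
    rw [← e.prod_comp, Fintype.prod_prod_type]
    refine Finset.prod_congr rfl fun j _ => ?_
    rw [Fintype.prod_bool, mul_eq_sum_reluSq, add_zero]
    rw [Equiv.sum_comp (Fintype.equivFin κ).symm
      (fun q => w i j q * reluSq (∑ l, a' q l * x l + b' q))]
    symm
    change ∑ q : ι × Fin (2 ^ k) × (Bool × Bool), _ = _
    rw [Fintype.sum_prod_type, Finset.sum_eq_single i, Fintype.sum_prod_type,
      Finset.sum_eq_single j]
    · refine Finset.sum_congr rfl fun s _ => ?_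
      simp only [w, a', b', sg, and_self, if_true, add_mul, mul_add, Finset.sum_add_distrib,
        Finset.mul_sum, mul_assoc]
      congr 2
      ring
    · intro j' _ hj'
      simp [w, hj']
    · simp
    · intro i' _ hi'
      simp [w, hi']
    · simp

/-- A sum of `card ι` products of `d` factors, each factor a linear combination of the units of a
common first hidden layer. The factors are padded with ones up to the next power of two. -/
theorem isNet_sum_prod_reluSq {d : ℕ} {ι κ : Type} [Fintype ι] [Fintype κ] (c : ι → ℝ)
    (a : ι → Fin d → κ → ℝ) (w : κ → Fin d → ℝ) (s : κ → ℝ) :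
    IsNet (Nat.clog 2 d + 2)
      (max (max d 1) (max (Fintype.card κ) (2 * Fintype.card ι * 2 ^ Nat.clog 2 d)))
      (fun x => ∑ i, c i * ∏ j, ∑ q, a i j q * reluSq (∑ l, w q l * x l + s q)) := by
  have hd : d ≤ 2 ^ Nat.clog 2 d := Nat.le_pow_clog (by norm_num) d
  have h := (isNet_sum_prod (Nat.clog 2 d) (n := Fintype.card κ) c
    (fun i j l => if h : j.1 < d then a i ⟨j.1, h⟩ ((Fintype.equivFin κ).symm l) else 0)
    (fun _ j => if j.1 < d then 0 else 1)).hidden w s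
  have hmono := h.mono (W' := max (max d 1)
    (max (Fintype.card κ) (2 * Fintype.card ι * 2 ^ Nat.clog 2 d))) (by omega)
  convert hmono using 2 with x
  refine Finset.sum_congr rfl fun i _ => ?_
  congr 1
  let F : ℕ → ℝ := fun j => if h : j < d then
    ∑ q, a i ⟨j, h⟩ q * reluSq (∑ l, w q l * x l + s q) else 1
  have e1 : ∏ j : Fin d, ∑ q, a i j q * reluSq (∑ l, w q l * x l + s q) =
      ∏ j : Fin d, F j := by
    refine Finset.prod_congr rfl fun j _ => ?_
    simp [F]
  have e2 : ∏ j ∈ Finset.range (2 ^ Nat.clog 2 d), F j = ∏ j ∈ Finset.range d, F j := by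
    rw [← Finset.prod_range_mul_prod_Ico F hd, Finset.prod_eq_one (s := Finset.Ico _ _), mul_one]
    intro j hj
    simp [F, (Finset.mem_Ico.1 hj).1]
  rw [e1, Fin.prod_univ_eq_prod_range, ← e2, ← Fin.prod_univ_eq_prod_range]
  refine Finset.prod_congr rfl fun j _ => ?_
  by_cases hj : j.1 < d
  · simp only [hj, dif_pos, if_true, add_zero, F]
    exact (Equiv.sum_comp (Fintype.equivFin κ).symm
      (fun q => a i ⟨j, hj⟩ q * reluSq (∑ l, w q l * x l + s q))).symm
  · simp [F, hj]

/-! ### Boundedness on the cube -/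

theorem cube_subset_Icc (d : ℕ) : cube d ⊆ Set.Icc 0 1 :=
  fun _ hx => ⟨fun i => (hx i).1.le, fun i => (hx i).2.le⟩

theorem _root_.Continuous.exists_abs_le_cube {d : ℕ} {f : (Fin d → ℝ) → ℝ} (hf : Continuous f) :
    ∃ B, ∀ x ∈ cube d, |f x| ≤ B := by
  obtain ⟨B, hB⟩ := (isCompact_Icc (a := (0 : Fin d → ℝ)) (b := 1)).exists_bound_of_continuousOn
    hf.continuousOn
  exact ⟨B, fun x hx => hB x (cube_subset_Icc d hx)⟩

theorem _root_.ContDiff.continuous_partialDeriv {d : ℕ} {f : (Fin d → ℝ) → ℝ}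
    (hf : ContDiff ℝ 1 f) (i : Fin d) : Continuous (partialDeriv i f) :=
  (hf.continuous_fderiv one_ne_zero).clm_apply continuous_const

/-- A network function belongs to a class `𝓝²_{D,W,B}` for some bound `B`, because it is
continuously differentiable and the closed cube is compact. -/
theorem IsNet.exists_mem_reluSqClass {d L W : ℕ} {f : (Fin d → ℝ) → ℝ} (h : IsNet L W f) :
    ∃ W' ≤ W, ∃ B, f ∈ reluSqClass d L W' B := by
  have hf := h.contDiff
  obtain ⟨B₁, h₁⟩ := hf.continuous.exists_abs_le_cube
  obtain ⟨B₂, h₂⟩ := (continuous_finsetSum Finset.univ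
    fun i _ => (hf.continuous_partialDeriv i).pow 2).exists_abs_le_cube
  obtain ⟨net, hL, hW, hnet⟩ := h
  exact ⟨net.width, hW, max B₁ B₂, ⟨net, hL, rfl, hnet⟩, fun x hx =>
    ⟨(h₁ x hx).trans (le_max_left _ _), (le_abs_self _).trans ((h₂ x hx).trans (le_max_right _ _))⟩⟩

/-! ### Weak partial derivatives -/

section WeakPartial

variable {d : ℕ} {Ω : Set (Fin d → ℝ)} {i : Fin d}

theorem cube_eq_pi (d : ℕ) : cube d = Set.univ.pi fun _ => Set.Ioo 0 1 := by
  ext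
  simp [cube, Set.mem_pi]

theorem isOpen_cube (d : ℕ) : IsOpen (cube d) := by
  rw [cube_eq_pi]
  exact isOpen_set_pi Set.finite_univ fun _ _ => isOpen_Ioo

theorem measurableSet_cube (d : ℕ) : MeasurableSet (cube d) := (isOpen_cube d).measurableSet

instance (d : ℕ) : IsFiniteMeasure ((volume : Measure (Fin d → ℝ)).restrict (cube d)) :=
  ⟨by
    rw [Measure.restrict_apply_univ]
    exact (measure_mono (cube_subset_Icc d)).trans_lt isCompact_Icc.measure_lt_top⟩

theorem IsTestFunction.partialDeriv {φ : (Fin d → ℝ) → ℝ} (hφ : IsTestFunction Ω φ) (i : Fin d) :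
    IsTestFunction Ω (partialDeriv i φ) where
  smooth := (hφ.smooth.fderiv_right (m := ∞) (by simp)).clm_apply contDiff_const
  compact := hφ.compact.fderiv_apply (𝕜 := ℝ) _
  support := (closure_minimal (fun x hx => by
    by_contra h
    refine hx ?_
    have : fderiv ℝ φ x = 0 := image_eq_zero_of_notMem_tsupport fun h' =>
      h (tsupport_fderiv_subset ℝ h')
    simp [DeepRitz.partialDeriv, this]) (isClosed_tsupport φ)).trans hφ.support

theorem IsTestFunction.integrable_mul {φ v : (Fin d → ℝ) → ℝ} (hφ : IsTestFunction Ω φ)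
    (hv : LocallyIntegrableOn v Ω) : Integrable (fun x => v x * φ x) := by
  have h1 : IntegrableOn v (tsupport φ) := hv.integrableOn_compact_subset hφ.support hφ.compact
  have h2 : IntegrableOn (fun x => v x * φ x) (tsupport φ) :=
    h1.mul_continuousOn hφ.smooth.continuous.continuousOn hφ.compact
  refine (integrableOn_iff_integrable_of_support_subset fun x hx => ?_).1 h2
  exact subset_tsupport φ fun h => hx (by simp [h])

theorem IsTestFunction.setIntegral_mul {φ : (Fin d → ℝ) → ℝ} (hφ : IsTestFunction Ω φ)
    (v : (Fin d → ℝ) → ℝ) : ∫ x in Ω, v x * φ x = ∫ x, v x * φ x := by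
  refine setIntegral_eq_integral_of_forall_compl_eq_zero fun x hx => ?_
  rw [image_eq_zero_of_notMem_tsupport fun h => hx (hφ.support h), mul_zero]

theorem HasWeakPartial.ae_eq {u v w : (Fin d → ℝ) → ℝ} (hΩ : IsOpen Ω)
    (hv : HasWeakPartial Ω i u v) (hw : HasWeakPartial Ω i u w) :
    v =ᵐ[volume.restrict Ω] w := by
  have := hΩ.ae_eq_zero_of_integral_contDiff_smul_eq_zero (μ := volume)
    (hv.locInt_deriv.sub hw.locInt_deriv) (fun φ h1 h2 h3 => by
      have hφ : IsTestFunction Ω φ := ⟨h1, h2, h3⟩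
      have e := (hv.integral_eq φ hφ).symm.trans (hw.integral_eq φ hφ)
      rw [hφ.setIntegral_mul, hφ.setIntegral_mul, neg_inj] at e
      simp only [smul_eq_mul, Pi.sub_apply, mul_comm (φ _), sub_mul]
      rw [integral_sub (hφ.integrable_mul hv.locInt_deriv) (hφ.integrable_mul hw.locInt_deriv), e,
        sub_self])
  rw [Filter.EventuallyEq, ae_restrict_iff' hΩ.measurableSet]
  filter_upwards [this] with x hx hxΩ
  exact sub_eq_zero.1 (hx hxΩ)

theorem HasWeakPartial.congr {u u' v : (Fin d → ℝ) → ℝ} (h : HasWeakPartial Ω i u v)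
    (hu' : LocallyIntegrableOn u' Ω) (huu' : u =ᵐ[volume.restrict Ω] u') :
    HasWeakPartial Ω i u' v where
  locInt := hu'
  locInt_deriv := h.locInt_deriv
  integral_eq φ hφ := by
    rw [← h.integral_eq φ hφ]
    refine integral_congr_ae ?_
    filter_upwards [huu'] with x hx
    rw [hx]

theorem HasWeakPartial.sub {u u' v v' : (Fin d → ℝ) → ℝ} (h : HasWeakPartial Ω i u v)
    (h' : HasWeakPartial Ω i u' v') :
    HasWeakPartial Ω i (fun x => u x - u' x) (fun x => v x - v' x) where
  locInt := h.locInt.sub h'.locInt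
  locInt_deriv := h.locInt_deriv.sub h'.locInt_deriv
  integral_eq φ hφ := by
    have hφ' := hφ.partialDeriv i
    have e := h.integral_eq φ hφ
    have e' := h'.integral_eq φ hφ
    rw [hφ.setIntegral_mul, hφ'.setIntegral_mul] at *
    simp only [sub_mul]
    rw [integral_sub (hφ'.integrable_mul h.locInt) (hφ'.integrable_mul h'.locInt),
      integral_sub (hφ.integrable_mul h.locInt_deriv) (hφ.integrable_mul h'.locInt_deriv), e, e']
    ring

theorem hasWeakPartial_of_contDiff {f : (Fin d → ℝ) → ℝ} (hf : ContDiff ℝ 1 f) (i : Fin d) :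
    HasWeakPartial Ω i f (partialDeriv i f) where
  locInt := (hf.continuous.locallyIntegrable).locallyIntegrableOn _
  locInt_deriv := ((hf.continuous_partialDeriv i).locallyIntegrable).locallyIntegrableOn _
  integral_eq φ hφ := by
    have hφ' := hφ.partialDeriv i
    have h1 := (hf.continuous.locallyIntegrable (μ := volume)).locallyIntegrableOn Ω
    have h2 := ((hf.continuous_partialDeriv i).locallyIntegrable
      (μ := volume)).locallyIntegrableOn Ω
    rw [hφ.setIntegral_mul, hφ'.setIntegral_mul]
    exact integral_mul_fderiv_eq_neg_fderiv_mul_of_integrable (hφ.integrable_mul h2)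
      (hφ'.integrable_mul h1) (hφ.integrable_mul h1)
      (fun x _ => (hf.differentiable one_ne_zero).differentiableAt)
      (fun x _ => (hφ.smooth.differentiable (by simp)).differentiableAt)

theorem HasWeakPartial.to_weakPartial {u v : (Fin d → ℝ) → ℝ} (h : HasWeakPartial Ω i u v) :
    HasWeakPartial Ω i u (weakPartial Ω i u) := by
  have h' : ∃ v, HasWeakPartial Ω i u v := ⟨v, h⟩
  rw [weakPartial, dif_pos h']
  exact h'.choose_spec

theorem HasWeakPartial.weakPartial_ae_eq {u v : (Fin d → ℝ) → ℝ} (hΩ : IsOpen Ω)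
    (h : HasWeakPartial Ω i u v) : weakPartial Ω i u =ᵐ[volume.restrict Ω] v :=
  h.to_weakPartial.ae_eq hΩ h

end WeakPartial

/-! ### Norms -/

section Norms

variable {d : ℕ} {Ω : Set (Fin d → ℝ)}

theorem normL2Sq_nonneg (Ω : Set (Fin d → ℝ)) (u : (Fin d → ℝ) → ℝ) : 0 ≤ normL2Sq Ω u :=
  integral_nonneg fun _ => sq_nonneg _

theorem normL2Sq_congr {u v : (Fin d → ℝ) → ℝ} (h : u =ᵐ[volume.restrict Ω] v) :
    normL2Sq Ω u = normL2Sq Ω v := by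
  refine integral_congr_ae ?_
  filter_upwards [h] with x hx
  rw [hx]

theorem MemL2.normL2Sq_mono {u v : (Fin d → ℝ) → ℝ} (hΩ : MeasurableSet Ω) (hv : MemL2 Ω v)
    (h : ∀ x ∈ Ω, |u x| ≤ |v x|) : normL2Sq Ω u ≤ normL2Sq Ω v := by
  refine integral_mono_of_nonneg (Filter.Eventually.of_forall fun _ => sq_nonneg _)
    hv.integrable_sq ?_
  filter_upwards [ae_restrict_mem hΩ] with x hx
  exact sq_le_sq.2 (h x hx)

theorem MemL2.normL2Sq_add_le {u v : (Fin d → ℝ) → ℝ} (hu : MemL2 Ω u) (hv : MemL2 Ω v) :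
    normL2Sq Ω (fun x => u x + v x) ≤ 2 * normL2Sq Ω u + 2 * normL2Sq Ω v := by
  simp only [normL2Sq]
  rw [← integral_const_mul, ← integral_const_mul,
    ← integral_add (hu.integrable_sq.const_mul 2) (hv.integrable_sq.const_mul 2)]
  refine integral_mono (hu.add hv).integrable_sq
    ((hu.integrable_sq.const_mul 2).add (hv.integrable_sq.const_mul 2)) fun x => ?_
  nlinarith [sq_nonneg (u x - v x)]

theorem normL2Sq_const_mul (c : ℝ) (u : (Fin d → ℝ) → ℝ) :
    normL2Sq Ω (fun x => c * u x) = c ^ 2 * normL2Sq Ω u := by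
  simp only [normL2Sq, mul_pow, integral_const_mul]

theorem memL2_sum {ι : Type*} {s : Finset ι} {f : ι → (Fin d → ℝ) → ℝ}
    (h : ∀ k ∈ s, MemL2 Ω (f k)) : MemL2 Ω (fun x => ∑ k ∈ s, f k x) :=
  memLp_finsetSum s h

theorem normL2Sq_sum_le {ι : Type*} {s : Finset ι} {f : ι → (Fin d → ℝ) → ℝ}
    (h : ∀ k ∈ s, MemL2 Ω (f k)) :
    normL2Sq Ω (fun x => ∑ k ∈ s, f k x) ≤ s.card * ∑ k ∈ s, normL2Sq Ω (f k) := by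
  simp only [normL2Sq]
  rw [← integral_finsetSum s fun k hk => (h k hk).integrable_sq, ← integral_const_mul]
  refine integral_mono (memL2_sum h).integrable_sq
    ((integrable_finsetSum s fun k hk => (h k hk).integrable_sq).const_mul _) fun x => ?_
  exact sq_sum_le_card_mul_sum_sq

theorem MemL2.of_continuous {f : (Fin d → ℝ) → ℝ} (hf : Continuous f) : MemL2 (cube d) f := by
  obtain ⟨B, hB⟩ := hf.exists_abs_le_cube
  refine MemLp.of_bound hf.aestronglyMeasurable B ?_
  filter_upwards [ae_restrict_mem (measurableSet_cube d)] with x hx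
  exact hB x hx

theorem sq_normH1 (Ω : Set (Fin d → ℝ)) (u : (Fin d → ℝ) → ℝ) :
    normH1 Ω u ^ 2 = normL2Sq Ω u + ∑ i, normL2Sq Ω (weakPartial Ω i u) :=
  Real.sq_sqrt (add_nonneg (normL2Sq_nonneg _ _)
    (Finset.sum_nonneg fun _ _ => normL2Sq_nonneg _ _))

theorem sq_normH2 (Ω : Set (Fin d → ℝ)) (u : (Fin d → ℝ) → ℝ) :
    normH2 Ω u ^ 2 = normL2Sq Ω u + ∑ i, normL2Sq Ω (weakPartial Ω i u) +
    ∑ j, ∑ i ∈ Finset.univ.filter (fun i => i ≤ j),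
      normL2Sq Ω (weakPartial Ω i (weakPartial Ω j u)) :=
  Real.sq_sqrt (add_nonneg (add_nonneg (normL2Sq_nonneg _ _)
    (Finset.sum_nonneg fun _ _ => normL2Sq_nonneg _ _))
    (Finset.sum_nonneg fun _ _ => Finset.sum_nonneg fun _ _ => normL2Sq_nonneg _ _))

theorem normH1_le_normH2 (Ω : Set (Fin d → ℝ)) (u : (Fin d → ℝ) → ℝ) :
    normH1 Ω u ≤ normH2 Ω u :=
  Real.sqrt_le_sqrt (le_add_of_nonneg_right
    (Finset.sum_nonneg fun _ _ => Finset.sum_nonneg fun _ _ => normL2Sq_nonneg _ _))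

theorem normH1_nonneg (Ω : Set (Fin d → ℝ)) (u : (Fin d → ℝ) → ℝ) : 0 ≤ normH1 Ω u :=
  Real.sqrt_nonneg _

/-- First-order part of the structure of `u ∈ H²(Ω)`, in terms of the chosen derivatives. -/
theorem MemH2.hasWeakPartial {u : (Fin d → ℝ) → ℝ} (hΩ : IsOpen Ω) (hu : MemH2 Ω u) (i : Fin d) :
    HasWeakPartial Ω i u (weakPartial Ω i u) ∧ MemL2 Ω (weakPartial Ω i u) := by
  obtain ⟨v, hv, hv2⟩ := hu.2 i
  exact ⟨hv.to_weakPartial, (memLp_congr_ae (hv.weakPartial_ae_eq hΩ)).2 hv2.1⟩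

/-- Second-order part of the structure of `u ∈ H²(Ω)`, in terms of the chosen derivatives. -/
theorem MemH2.hasWeakPartial_weakPartial {u : (Fin d → ℝ) → ℝ} (hΩ : IsOpen Ω) (hu : MemH2 Ω u)
    (i j : Fin d) :
    HasWeakPartial Ω i (weakPartial Ω j u)
      (weakPartial Ω i (weakPartial Ω j u)) ∧
    MemL2 Ω (weakPartial Ω i (weakPartial Ω j u)) := by
  obtain ⟨v, hv, hv2⟩ := hu.2 j
  obtain ⟨w, hw, hw2⟩ := hv2.2 i
  have h := hw.congr hv.to_weakPartial.locInt_deriv (hv.weakPartial_ae_eq hΩ).symm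
  exact ⟨h.to_weakPartial, (memLp_congr_ae (h.weakPartial_ae_eq hΩ)).2 hw2⟩

/-- Subtracting a `C¹` function from an `H²` function gives an `H¹` function, and its norm is
computed with the classical derivatives. -/
theorem MemH2.sub_contDiff {u f : (Fin d → ℝ) → ℝ} (hu : MemH2 (cube d) u)
    (hf : ContDiff ℝ 1 f) :
    MemH1 (cube d) (fun x => u x - f x) ∧
    normH1 (cube d) (fun x => u x - f x) ^ 2 = normL2Sq (cube d) (fun x => u x - f x) +
      ∑ i, normL2Sq (cube d) (fun x => weakPartial (cube d) i u x - partialDeriv i f x) := by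
  have h1 := fun i => (hu.hasWeakPartial (isOpen_cube d) i).1.sub
    (hasWeakPartial_of_contDiff (Ω := cube d) hf i)
  refine ⟨⟨hu.1.sub (MemL2.of_continuous hf.continuous), fun i => ⟨_, h1 i,
    (hu.hasWeakPartial (isOpen_cube d) i).2.sub
      (MemL2.of_continuous (hf.continuous_partialDeriv i))⟩⟩, ?_⟩
  rw [sq_normH1]
  congr 1
  exact Finset.sum_congr rfl fun i _ => normL2Sq_congr ((h1 i).weakPartial_ae_eq (isOpen_cube d))

end Norms

/-! ### Mollification -/

theorem sq_lintegral_le {Y : Type*} [MeasurableSpace Y] (ν : Measure Y) {g : Y → ℝ≥0∞}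
    (hg : AEMeasurable g ν) : (∫⁻ y, g y ∂ν) ^ 2 ≤ ν Set.univ * ∫⁻ y, g y ^ 2 ∂ν := by
  have h := ENNReal.lintegral_mul_le_Lp_mul_Lq ν Real.HolderConjugate.two_two hg
    (aemeasurable_const (b := (1 : ℝ≥0∞)))
  simp only [Pi.mul_apply, mul_one, lintegral_const, ENNReal.rpow_two, one_pow, one_mul] at h
  have hsq : ∀ a : ℝ≥0∞, (a ^ (1 / 2 : ℝ)) ^ 2 = a := fun a => by
    rw [← ENNReal.rpow_natCast, ← ENNReal.rpow_mul]; norm_num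
  calc (∫⁻ y, g y ∂ν) ^ 2 ≤ _ := pow_le_pow_left' h 2
    _ = _ := by rw [mul_pow, hsq, hsq, mul_comm]

/-- Jensen's inequality for a superposition of functions, in `L²`. -/
theorem lintegral_sq_lintegral_le {X Y : Type*} [MeasurableSpace X] [MeasurableSpace Y]
    (μ : Measure X) (ν : Measure Y) [SFinite μ] [SFinite ν] {f : X → Y → ℝ≥0∞}
    (hf : Measurable (Function.uncurry f)) :
    ∫⁻ x, (∫⁻ y, f x y ∂ν) ^ 2 ∂μ ≤ ν Set.univ * ∫⁻ y, ∫⁻ x, f x y ^ 2 ∂μ ∂ν := by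
  have hsq : Measurable (Function.uncurry fun x y => f x y ^ 2) := hf.pow_const 2
  rw [lintegral_lintegral_swap (f := fun y x => f x y ^ 2)
    (hsq.comp measurable_swap).aemeasurable, ← lintegral_const_mul _ hsq.lintegral_prod_right]
  exact lintegral_mono fun x => sq_lintegral_le ν hf.of_uncurry_left.aemeasurable

section Mollify

variable {d : ℕ}

/-- The mean of `f` around a point, weighted by the normalized bump function `φ`. -/
noncomputable def mollify (φ : ContDiffBump (0 : Fin d → ℝ)) (f : (Fin d → ℝ) → ℝ) :
    (Fin d → ℝ) → ℝ :=
  convolution (φ.normed volume) f (ContinuousLinearMap.lsmul ℝ ℝ) volume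

variable (φ : ContDiffBump (0 : Fin d → ℝ))

theorem contDiff_mollify {f : (Fin d → ℝ) → ℝ} (hf : LocallyIntegrable f) :
    ContDiff ℝ ∞ (mollify φ f) :=
  (φ.hasCompactSupport_normed (μ := volume)).contDiff_convolution_left _ φ.contDiff_normed hf

theorem mollify_sub {f g : (Fin d → ℝ) → ℝ} (hf : LocallyIntegrable f)
    (hg : LocallyIntegrable g) (x : Fin d → ℝ) :
    mollify φ (fun x => f x - g x) x = mollify φ f x - mollify φ g x := by
  have h1 := (φ.hasCompactSupport_normed (μ := volume)).convolutionExists_left (μ := volume)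
    (ContinuousLinearMap.lsmul ℝ ℝ) φ.continuous_normed hf x
  have h2 := (φ.hasCompactSupport_normed (μ := volume)).convolutionExists_left (μ := volume)
    (ContinuousLinearMap.lsmul ℝ ℝ) φ.continuous_normed hg x
  simp only [mollify, convolution]
  rw [← integral_sub h1.integrable h2.integrable]
  simp [mul_sub]

theorem mollify_congr {f g : (Fin d → ℝ) → ℝ} (h : f =ᵐ[volume] g) :
    mollify φ f = mollify φ g :=
  convolution_congr _ Filter.EventuallyEq.rfl h

theorem mollify_eq_setIntegral (Ω : Set (Fin d → ℝ)) (hΩ : MeasurableSet Ω)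
    (f : (Fin d → ℝ) → ℝ) (x : Fin d → ℝ) :
    mollify φ (Ω.indicator f) x = ∫ y in Ω, f y * φ.normed volume (x - y) := by
  rw [mollify, convolution_eq_swap, ← integral_indicator hΩ]
  congr 1 with y
  by_cases hy : y ∈ Ω <;> simp [hy, mul_comm]

theorem isTestFunction_normed_sub {Ω : Set (Fin d → ℝ)} {x : Fin d → ℝ}
    (hx : Metric.closedBall x φ.rOut ⊆ Ω) :
    IsTestFunction Ω (fun y => φ.normed volume (x - y)) := by
  have hts : tsupport (fun y => φ.normed (volume : Measure (Fin d → ℝ)) (x - y)) ⊆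
      Metric.closedBall x φ.rOut := by
    refine closure_minimal (fun y hy => ?_) Metric.isClosed_closedBall
    have : x - y ∈ Function.support (φ.normed (volume : Measure (Fin d → ℝ))) := hy
    rw [φ.support_normed_eq, mem_ball_zero_iff] at this
    rw [Metric.mem_closedBall, dist_comm, dist_eq_norm]
    exact this.le
  exact ⟨φ.contDiff_normed.comp (contDiff_const.sub contDiff_id),
    HasCompactSupport.intro (isCompact_closedBall x φ.rOut)
      fun y hy => by_contra fun h => hy (hts (subset_tsupport _ h)), hts.trans hx⟩

/-- Away from the boundary of `Ω`, mollification commutes with weak differentiation. -/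
theorem HasWeakPartial.partialDeriv_mollify {Ω : Set (Fin d → ℝ)} (hΩ : MeasurableSet Ω)
    {i : Fin d} {u v : (Fin d → ℝ) → ℝ} (h : HasWeakPartial Ω i u v)
    (hu : LocallyIntegrable (Ω.indicator u)) {x : Fin d → ℝ}
    (hx : Metric.closedBall x φ.rOut ⊆ Ω) :
    partialDeriv i (mollify φ (Ω.indicator u)) x = mollify φ (Ω.indicator v) x := by
  let L := ContinuousLinearMap.lsmul ℝ ℝ (E := ℝ)
  have hφ1 : ContDiff ℝ 1 (φ.normed (volume : Measure (Fin d → ℝ))) := φ.contDiff_normed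
  have hφd := φ.hasCompactSupport_normed (μ := volume) |>.fderiv (𝕜 := ℝ)
  have hfd := φ.hasCompactSupport_normed (μ := volume) |>.hasFDerivAt_convolution_right L.flip hu
    hφ1 x
  rw [convolution_flip] at hfd
  have hT := isTestFunction_normed_sub φ hx
  rw [partialDeriv, mollify, hfd.fderiv, convolution_precompR_apply _ hu hφd
    (hφ1.continuous_fderiv one_ne_zero), convolution_flip, mollify_eq_setIntegral φ Ω hΩ,
    ← neg_eq_iff_eq_neg.2 (h.integral_eq _ hT), convolution_eq_swap, ← integral_indicator hΩ,
    ← integral_neg]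
  congr 1 with y
  have e : partialDeriv i (fun y => φ.normed volume (x - y)) y =
      - fderiv ℝ (φ.normed volume) (x - y) (Pi.single i 1) := by
    have := (hφ1.differentiable one_ne_zero (x - y)).hasFDerivAt.comp y
      ((hasFDerivAt_const x y).sub (hasFDerivAt_id y))
    rw [partialDeriv]
    erw [this.fderiv]
    simp
  by_cases hy : y ∈ Ω <;> simp [hy, e, L, mul_comm]

theorem eLpNorm_two_sq {X : Type*} [MeasurableSpace X] (μ : Measure X) (f : X → ℝ) :
    eLpNorm f 2 μ ^ 2 = ∫⁻ x, ‖f x‖ₑ ^ 2 ∂μ := by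
  have := eLpNorm_nnreal_pow_eq_lintegral (f := f) (μ := μ) (p := 2) (by norm_num)
  simpa using this

/-- Young's inequality: averaging does not increase the `L²` norm. -/
theorem eLpNorm_mollify_le {f : (Fin d → ℝ) → ℝ} (hf : AEStronglyMeasurable f) :
    eLpNorm (mollify φ f) 2 volume ≤ eLpNorm f 2 volume := by
  rw [mollify_congr φ hf.ae_eq_mk, eLpNorm_congr_ae hf.ae_eq_mk]
  have hg := hf.stronglyMeasurable_mk.measurable
  set g := hf.mk f
  rw [← ENNReal.pow_le_pow_left_iff two_ne_zero, eLpNorm_two_sq, eLpNorm_two_sq]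
  have hφm : Measurable fun y => ENNReal.ofReal (φ.normed (volume : Measure (Fin d → ℝ)) y) :=
    φ.continuous_normed.measurable.ennreal_ofReal
  let ν := (volume : Measure (Fin d → ℝ)).withDensity
    fun y => ENNReal.ofReal (φ.normed volume y)
  have hν : ν Set.univ = 1 := by
    rw [withDensity_apply _ MeasurableSet.univ, Measure.restrict_univ,
      ← ofReal_integral_eq_lintegral_ofReal φ.integrable_normed
        (Filter.Eventually.of_forall φ.nonneg_normed), φ.integral_normed, ENNReal.ofReal_one]
  have hu : Measurable (Function.uncurry fun x y : Fin d → ℝ => ‖g (x - y)‖ₑ) :=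
    (hg.comp (measurable_fst.sub measurable_snd)).enorm
  calc ∫⁻ x, ‖mollify φ g x‖ₑ ^ 2 ≤ ∫⁻ x, (∫⁻ y, ‖g (x - y)‖ₑ ∂ν) ^ 2 := by
        refine lintegral_mono fun x => pow_le_pow_left' ?_ 2
        refine (enorm_integral_le_lintegral_enorm _).trans_eq ?_
        rw [lintegral_withDensity_eq_lintegral_mul _ hφm hu.of_uncurry_left]
        refine lintegral_congr fun y => ?_
        simp [enorm_mul, Real.enorm_of_nonneg (φ.nonneg_normed y)]
    _ ≤ ν Set.univ * ∫⁻ y, (∫⁻ x, ‖g (x - y)‖ₑ ^ 2) ∂ν := lintegral_sq_lintegral_le _ _ hu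
    _ = ∫⁻ x, ‖g x‖ₑ ^ 2 := by
        simp only [lintegral_sub_right_eq_self (fun x => ‖g x‖ₑ ^ 2), lintegral_const, hν]
        simp

end Mollify

/-! ### Shrinking the cube -/

section Shrink

variable {d : ℕ}

/-- The dilation with factor `l` about the centre of the unit cube. -/
noncomputable def shrink (l : ℝ) (x : Fin d → ℝ) : Fin d → ℝ := l • x + fun _ => (1 - l) / 2

theorem shrink_apply (l : ℝ) (x : Fin d → ℝ) (i : Fin d) :
    shrink l x i = l * x i + (1 - l) / 2 := rfl

theorem contDiff_shrink (l : ℝ) {n : WithTop ℕ∞} : ContDiff ℝ n (shrink (d := d) l) :=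
  (contDiff_id.const_smul l).add contDiff_const

theorem dist_shrink_le {l : ℝ} (hl : l ≤ 1) {x : Fin d → ℝ} (hx : x ∈ cube d) :
    dist (shrink l x) x ≤ 1 - l := by
  refine (dist_pi_le_iff (by linarith)).2 fun i => ?_
  have h1 := (hx i).1
  have h2 := (hx i).2
  rw [shrink_apply, Real.dist_eq, abs_le]
  constructor <;> nlinarith

theorem closedBall_shrink_subset {l r : ℝ} (hl : 0 < l) (hr : r ≤ (1 - l) / 2)
    {x : Fin d → ℝ} (hx : x ∈ cube d) : Metric.closedBall (shrink l x) r ⊆ cube d := by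
  intro y hy i
  have h := (dist_le_pi_dist y (shrink l x) i).trans hy
  rw [shrink_apply, Real.dist_eq, abs_le] at h
  have h1 := mul_pos hl (hx i).1
  have h2 := mul_lt_mul_of_pos_left (hx i).2 hl
  constructor <;> linarith

theorem lintegral_comp_shrink {l : ℝ} (hl : l ≠ 0) {F : (Fin d → ℝ) → ℝ≥0∞} (hF : Measurable F) :
    ∫⁻ x, F (shrink l x) = ENNReal.ofReal |(l ^ d)⁻¹| * ∫⁻ x, F x := by
  have h1 : ∫⁻ x, F (shrink l x) = ∫⁻ x, F (x + fun _ => (1 - l) / 2)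
      ∂(Measure.map (fun x => l • x) (volume : Measure (Fin d → ℝ))) := by
    rw [lintegral_map (f := fun x => F (x + fun _ => (1 - l) / 2)) (by fun_prop) (by fun_prop)]
    rfl
  rw [h1, Measure.map_addHaar_smul _ hl, lintegral_smul_measure, lintegral_add_right_eq_self]
  simp

theorem eLpNorm_comp_shrink_le {l : ℝ} (hl : 1 / 2 ≤ l) {F : (Fin d → ℝ) → ℝ} (hF : Measurable F) :
    eLpNorm (fun x => F (shrink l x)) 2 volume ^ 2 ≤ 2 ^ d * eLpNorm F 2 volume ^ 2 := by
  rw [eLpNorm_two_sq, eLpNorm_two_sq, lintegral_comp_shrink (F := fun x => ‖F x‖ₑ ^ 2)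
    (by linarith) (hF.enorm.pow_const 2)]
  gcongr
  rw [abs_inv, abs_of_nonneg (by positivity), ← inv_pow]
  have : l⁻¹ ≤ 2 := by rw [inv_le_comm₀ (by linarith) (by norm_num)]; linarith
  calc ENNReal.ofReal (l⁻¹ ^ d) ≤ ENNReal.ofReal (2 ^ d) :=
        ENNReal.ofReal_le_ofReal (pow_le_pow_left₀ (inv_nonneg.2 (by linarith)) this d)
    _ = 2 ^ d := by rw [ENNReal.ofReal_pow (by norm_num)]; simp

theorem partialDeriv_comp_shrink {f : (Fin d → ℝ) → ℝ} (hf : Differentiable ℝ f) (l : ℝ)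
    (i : Fin d) (x : Fin d → ℝ) :
    partialDeriv i (fun x => f (shrink l x)) x = l * partialDeriv i f (shrink l x) := by
  have h1 : HasFDerivAt (shrink l) (l • ContinuousLinearMap.id ℝ (Fin d → ℝ)) x :=
    ((hasFDerivAt_id x).const_smul l).add_const _
  have h2 := (hf (shrink l x)).hasFDerivAt.comp x h1
  rw [partialDeriv]
  erw [h2.fderiv]
  simp [partialDeriv]

end Shrink
/-! ### Approximation by smooth functions -/

section Smoothing

variable {d : ℕ}

theorem MemL2.eLpNorm_sq {Ω : Set (Fin d → ℝ)} {u : (Fin d → ℝ) → ℝ} (hu : MemL2 Ω u) :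
    eLpNorm u 2 (volume.restrict Ω) ^ 2 = ENNReal.ofReal (normL2Sq Ω u) := by
  rw [eLpNorm_two_sq, normL2Sq, ofReal_integral_eq_lintegral_ofReal hu.integrable_sq
    (Filter.Eventually.of_forall fun _ => sq_nonneg _)]
  refine lintegral_congr fun x => ?_
  rw [← Real.enorm_of_nonneg (sq_nonneg _), enorm_pow]

/-- Bump functions with supports shrinking to the origin. -/
noncomputable def bump (d k : ℕ) : ContDiffBump (0 : Fin d → ℝ) where
  rIn := 1 / (16 * ((k : ℝ) + 1))
  rOut := 1 / (8 * ((k : ℝ) + 1))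
  rIn_pos := by positivity
  rIn_lt_rOut := by
    have : (0 : ℝ) < k + 1 := by positivity
    exact one_div_lt_one_div_of_lt (by positivity) (by linarith)

/-- The dilation factor that goes with `bump d k`: the image of the cube keeps a distance of twice
the radius of the bump from the boundary of the cube. -/
noncomputable def factor (k : ℕ) : ℝ := 1 - 4 * (1 / (8 * ((k : ℝ) + 1)))

theorem half_le_factor (k : ℕ) : 1 / 2 ≤ factor k := by
  have : 1 / (8 * ((k : ℝ) + 1)) ≤ 1 / 8 :=
    one_div_le_one_div_of_le (by norm_num) (by linarith [Nat.cast_nonneg (α := ℝ) k])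
  rw [factor]; linarith

theorem factor_le_one (k : ℕ) : factor k ≤ 1 := by
  have : (0 : ℝ) ≤ 1 / (8 * ((k : ℝ) + 1)) := by positivity
  rw [factor]; linarith

theorem tendsto_rOut_bump (d : ℕ) :
    Filter.Tendsto (fun k => (bump d k).rOut) Filter.atTop (nhds 0) := by
  have h := (tendsto_one_div_add_atTop_nhds_zero_nat (𝕜 := ℝ)).const_mul (1 / 8)
  rw [mul_zero] at h
  refine h.congr fun k => ?_
  change _ = 1 / (8 * ((k : ℝ) + 1))
  field_simp

theorem tendsto_factor : Filter.Tendsto factor Filter.atTop (nhds 1) := by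
  have h := ((tendsto_rOut_bump 0).const_mul 4).const_sub 1
  rw [mul_zero, sub_zero] at h
  exact h

/-- A smooth approximation of `f` on the cube: `f` is mollified on a slightly smaller cube, and the
result is transported to the whole cube by a dilation. No values of `f` outside the cube enter. -/
noncomputable def smoothing (k : ℕ) (f : (Fin d → ℝ) → ℝ) (x : Fin d → ℝ) : ℝ :=
  mollify (bump d k) ((cube d).indicator f) (shrink (factor k) x)

variable {f g : (Fin d → ℝ) → ℝ}

theorem MemL2.memLp_indicator (hf : MemL2 (cube d) f) : MemLp ((cube d).indicator f) 2 :=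
  (memLp_indicator_iff_restrict (measurableSet_cube d)).2 hf

theorem MemL2.locallyIntegrable_indicator (hf : MemL2 (cube d) f) :
    LocallyIntegrable ((cube d).indicator f) :=
  hf.memLp_indicator.locallyIntegrable (by norm_num)

theorem contDiff_smoothing (k : ℕ) (hf : MemL2 (cube d) f) : ContDiff ℝ ∞ (smoothing k f) :=
  (contDiff_mollify _ hf.locallyIntegrable_indicator).comp (contDiff_shrink _)

theorem eLpNorm_mollify_shrink_le (k : ℕ) (hf : MemLp f 2) :
    eLpNorm (fun x => mollify (bump d k) f (shrink (factor k) x)) 2 volume ^ 2 ≤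
      2 ^ d * eLpNorm f 2 volume ^ 2 :=
  (eLpNorm_comp_shrink_le (half_le_factor k)
    (contDiff_mollify _ (hf.locallyIntegrable (by norm_num))).continuous.measurable).trans
    (by gcongr; exact eLpNorm_mollify_le _ hf.aestronglyMeasurable)

theorem normL2Sq_smoothing_le (k : ℕ) (hf : MemL2 (cube d) f) :
    normL2Sq (cube d) (smoothing k f) ≤ 2 ^ d * normL2Sq (cube d) f := by
  rw [← ENNReal.ofReal_le_ofReal_iff (by have := normL2Sq_nonneg (cube d) f; positivity),
    ← (MemL2.of_continuous (contDiff_smoothing k hf).continuous).eLpNorm_sq,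
    ENNReal.ofReal_mul (by positivity), ← hf.eLpNorm_sq, ENNReal.ofReal_pow (by norm_num),
    ← eLpNorm_indicator_eq_eLpNorm_restrict (f := f) (measurableSet_cube d)]
  simp only [ENNReal.ofReal_ofNat]
  refine le_trans ?_ (eLpNorm_mollify_shrink_le k hf.memLp_indicator)
  gcongr
  exact eLpNorm_mono_measure _ Measure.restrict_le_self

theorem volume_cube (d : ℕ) : volume (cube d) = 1 := by
  rw [cube_eq_pi, volume_pi_pi]
  simp

/-- Smoothings of a compactly supported continuous function converge uniformly on the cube. -/
theorem eventually_abs_mollify_sub_le (hg : Continuous g) (hgc : HasCompactSupport g) {η : ℝ}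
    (hη : 0 < η) : ∀ᶠ k in Filter.atTop, ∀ x ∈ cube d,
      ‖mollify (bump d k) g (shrink (factor k) x) - g x‖ ≤ η := by
  obtain ⟨δ, hδ, h⟩ := Metric.uniformContinuous_iff.1
    (hgc.uniformContinuous_of_continuous hg) (η / 2) (half_pos hη)
  have h2 := tendsto_factor.eventually (lt_mem_nhds (show 1 - δ < 1 by linarith))
  filter_upwards [(tendsto_rOut_bump d).eventually (gt_mem_nhds hδ), h2] with k hk hk2 x hx
  have e1 : dist (mollify (bump d k) g (shrink (factor k) x)) (g (shrink (factor k) x)) ≤ η / 2 :=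
    ContDiffBump.dist_normed_convolution_le hg.aestronglyMeasurable fun y hy =>
      (h (lt_trans hy hk)).le
  have e2 : dist (g (shrink (factor k) x)) (g x) ≤ η / 2 :=
    (h ((dist_shrink_le (factor_le_one k) hx).trans_lt (by linarith))).le
  rw [← dist_eq_norm]
  linarith [dist_triangle (mollify (bump d k) g (shrink (factor k) x))
    (g (shrink (factor k) x)) (g x)]

theorem tendsto_eLpNorm_mollify_sub (hf : MemLp f 2) :
    Filter.Tendsto (fun k => eLpNorm (fun x => mollify (bump d k) f (shrink (factor k) x) - f x) 2
      (volume.restrict (cube d))) Filter.atTop (nhds 0) := by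
  rw [ENNReal.tendsto_nhds_zero]
  intro ε hε
  rcases eq_or_ne ε ⊤ with rfl | hε'
  · simp
  -- `M` bounds the operator norm of smoothing on `L²`, so a third of `ε` remains for each error.
  let M : ℝ≥0∞ := 2 ^ d
  have hM : M ≠ ⊤ := by simp [M]
  have hM1 : 1 ≤ M := one_le_pow₀ (by norm_num)
  let η := ε / (3 * M)
  have hη : η ≠ 0 := ENNReal.div_ne_zero.2 ⟨hε.ne', ENNReal.mul_ne_top (by simp) hM⟩
  have hηM : 3 * (M * η) = ε := by
    rw [← mul_assoc]
    exact ENNReal.mul_div_cancel (by simp [M]) (ENNReal.mul_ne_top (by simp) hM)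
  have hηt : η ≠ ⊤ := fun h => hε' (by rw [← hηM, h]; simp [M])
  obtain ⟨g, hgc, hfg, hg, hgL⟩ := hf.exists_hasCompactSupport_eLpNorm_sub_le (by simp) hη
  filter_upwards [eventually_abs_mollify_sub_le hg hgc (ENNReal.toReal_pos hη hηt)] with k hk
  have hfl := hf.locallyIntegrable (by norm_num)
  have hgl := hgL.locallyIntegrable (by norm_num)
  have hsub : MemLp (fun x => f x - g x) 2 := hf.sub hgL
  have hdec : (fun x => mollify (bump d k) f (shrink (factor k) x) - f x) =
      (fun x => mollify (bump d k) (fun x => f x - g x) (shrink (factor k) x)) +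
      ((fun x => mollify (bump d k) g (shrink (factor k) x) - g x) - (f - g)) := by
    ext x
    simp only [Pi.add_apply, Pi.sub_apply, mollify_sub _ hfl hgl]
    ring
  have hcont : ∀ {h : (Fin d → ℝ) → ℝ}, MemLp h 2 →
      Continuous fun x => mollify (bump d k) h (shrink (factor k) x) := fun hh =>
    (contDiff_mollify _ (hh.locallyIntegrable (by norm_num))).continuous.comp
      (contDiff_shrink (n := 0) _).continuous
  have e1 : eLpNorm (fun x => mollify (bump d k) (fun x => f x - g x) (shrink (factor k) x)) 2
      (volume.restrict (cube d)) ≤ M * η := by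
    refine (eLpNorm_mono_measure _ Measure.restrict_le_self).trans ?_
    rw [← ENNReal.pow_le_pow_left_iff two_ne_zero, mul_pow]
    refine (eLpNorm_mollify_shrink_le k hsub).trans ?_
    exact mul_le_mul' (le_self_pow₀ hM1 two_ne_zero) (pow_le_pow_left' hfg 2)
  have e2 : eLpNorm (fun x => mollify (bump d k) g (shrink (factor k) x) - g x) 2
      (volume.restrict (cube d)) ≤ η := by
    refine (eLpNorm_le_of_ae_bound (C := η.toReal) ?_).trans ?_
    · filter_upwards [ae_restrict_mem (measurableSet_cube d)] with x hx using hk x hx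
    · simp [volume_cube, ENNReal.ofReal_toReal hηt]
  have e3 : eLpNorm (f - g) 2 (volume.restrict (cube d)) ≤ η :=
    (eLpNorm_mono_measure _ Measure.restrict_le_self).trans hfg
  have hm : η ≤ M * η := le_mul_of_one_le_left zero_le hM1
  rw [hdec]
  refine (eLpNorm_add_le (hcont hsub).aestronglyMeasurable
    (((hcont hgL).sub hg).aestronglyMeasurable.sub hsub.1.restrict) (by norm_num)).trans ?_
  refine (add_le_add_right (eLpNorm_sub_le ((hcont hgL).sub hg).aestronglyMeasurable
    hsub.1.restrict (by norm_num)) _).trans ?_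
  calc _ ≤ M * η + (M * η + M * η) := add_le_add e1 (add_le_add (e2.trans hm) (e3.trans hm))
    _ = ε := by rw [← hηM]; ring

theorem tendsto_normL2Sq_smoothing_sub (hf : MemL2 (cube d) f) :
    Filter.Tendsto (fun k => normL2Sq (cube d) (fun x => smoothing k f x - f x)) Filter.atTop
      (nhds 0) := by
  have h := ((ENNReal.continuous_pow 2).tendsto _).comp
    (tendsto_eLpNorm_mollify_sub hf.memLp_indicator)
  have h2 := (ENNReal.tendsto_toReal (by simp)).comp h
  simp only [ne_eq, OfNat.ofNat_ne_zero, not_false_eq_true, zero_pow, ENNReal.toReal_zero] at h2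
  refine h2.congr fun k => ?_
  have hm : MemL2 (cube d) (fun x => smoothing k f x - f x) :=
    (MemL2.of_continuous (contDiff_smoothing k hf).continuous).sub hf
  rw [← ENNReal.toReal_ofReal (normL2Sq_nonneg (cube d) _), ← hm.eLpNorm_sq]
  simp only [Function.comp]
  congr 2
  refine eLpNorm_congr_ae ?_
  filter_upwards [ae_restrict_mem (measurableSet_cube d)] with x hx
  simp [smoothing, hx]

theorem HasWeakPartial.partialDeriv_smoothing {i : Fin d} {u v : (Fin d → ℝ) → ℝ}
    (h : HasWeakPartial (cube d) i u v) (hu : MemL2 (cube d) u) (k : ℕ) {x : Fin d → ℝ}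
    (hx : x ∈ cube d) : partialDeriv i (smoothing k u) x = factor k * smoothing k v x := by
  have hl := hu.locallyIntegrable_indicator
  unfold smoothing
  rw [partialDeriv_comp_shrink ((contDiff_mollify _ hl).differentiable (by simp)),
    h.partialDeriv_mollify _ (measurableSet_cube d) hl]
  refine closedBall_shrink_subset (by linarith [half_le_factor k]) ?_ hx
  have : (0 : ℝ) ≤ 1 / (8 * ((k : ℝ) + 1)) := by positivity
  change 1 / (8 * ((k : ℝ) + 1)) ≤ _
  rw [factor]; linarith

theorem partialDeriv_congr_cube {i : Fin d} (h : ∀ x ∈ cube d, f x = g x) {x : Fin d → ℝ}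
    (hx : x ∈ cube d) : partialDeriv i f x = partialDeriv i g x := by
  have : f =ᶠ[nhds x] g := by
    filter_upwards [(isOpen_cube d).mem_nhds hx] with y hy using h y hy
  rw [partialDeriv, partialDeriv, this.fderiv_eq]

theorem normL2Sq_congr_cube (h : ∀ x ∈ cube d, f x = g x) :
    normL2Sq (cube d) f = normL2Sq (cube d) g :=
  normL2Sq_congr (by filter_upwards [ae_restrict_mem (measurableSet_cube d)] with x hx using h x hx)

/-- `H²` functions on the cube are limits in `H¹` of smooth functions that are bounded in `H²`. -/
theorem MemH2.exists_contDiff {u : (Fin d → ℝ) → ℝ} (hu : MemH2 (cube d) u) {η : ℝ}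
    (hη : 0 < η) : ∃ f : (Fin d → ℝ) → ℝ, ContDiff ℝ ∞ f ∧
      normL2Sq (cube d) (fun x => u x - f x) +
        ∑ i, normL2Sq (cube d) (fun x => weakPartial (cube d) i u x - partialDeriv i f x) ≤ η ∧
      (∀ i, normL2Sq (cube d) (partialDeriv i f) ≤
        2 ^ d * normL2Sq (cube d) (weakPartial (cube d) i u)) ∧
      ∀ i j, normL2Sq (cube d) (partialDeriv i (partialDeriv j f)) ≤
        2 ^ d * normL2Sq (cube d) (weakPartial (cube d) i (weakPartial (cube d) j u)) := by
  have h1 := fun i => hu.hasWeakPartial (isOpen_cube d) i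
  have h2 := fun i j => hu.hasWeakPartial_weakPartial (isOpen_cube d) i j
  have hp : ∀ k i, ∀ x ∈ cube d, partialDeriv i (smoothing k u) x =
      factor k * smoothing k (weakPartial (cube d) i u) x :=
    fun k i x hx => (h1 i).1.partialDeriv_smoothing hu.1 k hx
  have hpp : ∀ k i j, ∀ x ∈ cube d, partialDeriv i (partialDeriv j (smoothing k u)) x =
      factor k ^ 2 * smoothing k (weakPartial (cube d) i (weakPartial (cube d) j u)) x := by
    intro k i j x hx
    have hd := (contDiff_smoothing k (h1 j).2).differentiable (by simp) x
    rw [partialDeriv_congr_cube (hp k j) hx, partialDeriv, fderiv_const_mul hd]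
    change factor k * partialDeriv i _ x = _
    rw [(h2 i j).1.partialDeriv_smoothing (h1 j).2 k hx]
    ring
  have hf0 : ∀ k, 0 ≤ factor k := fun k => by linarith [half_le_factor k]
  have hf1 : ∀ k, factor k ^ 2 ≤ 1 := fun k => pow_le_one₀ (hf0 k) (factor_le_one k)
  -- the error of the first derivatives also contains the effect of the dilation factor
  have hb : ∀ k i, normL2Sq (cube d)
      (fun x => weakPartial (cube d) i u x - partialDeriv i (smoothing k u) x) ≤
      2 * (factor k ^ 2 * normL2Sq (cube d)
        (fun x => smoothing k (weakPartial (cube d) i u) x - weakPartial (cube d) i u x)) +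
      2 * ((1 - factor k) ^ 2 * normL2Sq (cube d) (weakPartial (cube d) i u)) := by
    intro k i
    have hm1 : MemL2 (cube d) (fun x => smoothing k (weakPartial (cube d) i u) x -
      weakPartial (cube d) i u x) :=
      (MemL2.of_continuous (contDiff_smoothing k (h1 i).2).continuous).sub (h1 i).2
    have hm2 := MemLp.const_mul hm1 (-factor k)
    have hm3 := MemLp.const_mul (h1 i).2 (1 - factor k)
    have h := MemL2.normL2Sq_add_le hm2 hm3
    rw [normL2Sq_const_mul, normL2Sq_const_mul, neg_sq] at h
    refine (normL2Sq_congr_cube fun x hx => ?_).trans_le h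
    rw [hp k i x hx]
    ring
  have ht : Filter.Tendsto (fun k => normL2Sq (cube d) (fun x => smoothing k u x - u x) +
      ∑ i, (2 * (factor k ^ 2 * normL2Sq (cube d)
        (fun x => smoothing k (weakPartial (cube d) i u) x - weakPartial (cube d) i u x)) +
      2 * ((1 - factor k) ^ 2 * normL2Sq (cube d) (weakPartial (cube d) i u)))) Filter.atTop
      (nhds (0 + ∑ i : Fin d, (2 * (1 ^ 2 * 0) +
        2 * ((1 - 1) ^ 2 * normL2Sq (cube d) (weakPartial (cube d) i u))))) :=
    (tendsto_normL2Sq_smoothing_sub hu.1).add (tendsto_finsetSum _ fun i _ =>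
      (((tendsto_factor.pow 2).mul (tendsto_normL2Sq_smoothing_sub (h1 i).2)).const_mul 2).add
        (((((tendsto_factor.const_sub 1).pow 2)).mul_const _).const_mul 2))
  obtain ⟨k, hk⟩ := (ht.eventually_lt_const (u := η) (by simpa using hη)).exists
  refine ⟨smoothing k u, contDiff_smoothing k hu.1, ?_, fun i => ?_, fun i j => ?_⟩
  · refine le_trans (add_le_add (le_of_eq ?_) (Finset.sum_le_sum fun i _ => hb k i)) hk.le
    simp only [normL2Sq]
    congr 1 with x
    ring
  · rw [normL2Sq_congr_cube (hp k i), normL2Sq_const_mul]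
    exact (mul_le_of_le_one_left (normL2Sq_nonneg _ _) (hf1 k)).trans
      (normL2Sq_smoothing_le k (h1 i).2)
  · rw [normL2Sq_congr_cube (hpp k i j), normL2Sq_const_mul]
    exact (mul_le_of_le_one_left (normL2Sq_nonneg _ _)
      (pow_le_one₀ (sq_nonneg _) (hf1 k))).trans (normL2Sq_smoothing_le k (h2 i j).2)

end Smoothing

/-! ### Quadratic B-splines -/

/-- A `C¹` function that equals `0` on `(-∞, 0]` and `t - 1/2` on `[1, ∞)`. -/
noncomputable def ramp (t : ℝ) : ℝ := (reluSq t - reluSq (t - 1)) / 2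

/-- The derivative of `ramp`. -/
noncomputable def rampDeriv (t : ℝ) : ℝ := max 0 t - max 0 (t - 1)

/-- The quadratic B-spline with knots `0, 1, 2, 3`, as a second difference of `ramp`. -/
noncomputable def bspline (t : ℝ) : ℝ := ramp t - 2 * ramp (t - 1) + ramp (t - 2)

/-- The derivative of `bspline`. -/
noncomputable def bsplineDeriv (t : ℝ) : ℝ :=
  rampDeriv t - 2 * rampDeriv (t - 1) + rampDeriv (t - 2)

theorem ramp_of_nonpos {t : ℝ} (ht : t ≤ 0) : ramp t = 0 := by
  simp [ramp, reluSq, max_eq_left ht, max_eq_left (show t - 1 ≤ 0 by linarith)]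

theorem ramp_of_one_le {t : ℝ} (ht : 1 ≤ t) : ramp t = t - 1 / 2 := by
  rw [ramp, reluSq, reluSq, max_eq_right (by linarith), max_eq_right (by linarith)]
  ring

theorem rampDeriv_of_nonpos {t : ℝ} (ht : t ≤ 0) : rampDeriv t = 0 := by
  simp [rampDeriv, max_eq_left ht, max_eq_left (show t - 1 ≤ 0 by linarith)]

theorem rampDeriv_of_one_le {t : ℝ} (ht : 1 ≤ t) : rampDeriv t = 1 := by
  rw [rampDeriv, max_eq_right (by linarith), max_eq_right (by linarith)]
  ring

theorem rampDeriv_of_mem {t : ℝ} (h0 : 0 ≤ t) (h1 : t ≤ 1) : rampDeriv t = t := by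
  rw [rampDeriv, max_eq_right h0, max_eq_left (by linarith), sub_zero]

theorem rampDeriv_mono : Monotone rampDeriv := by
  intro s t hst
  rcases le_total s 0 with h | h <;> rcases le_total s 1 with h' | h' <;>
    rcases le_total t 0 with k | k <;> rcases le_total t 1 with k' | k' <;>
    simp only [rampDeriv_of_nonpos, rampDeriv_of_one_le, rampDeriv_of_mem, *] <;> linarith

theorem rampDeriv_nonneg (t : ℝ) : 0 ≤ rampDeriv t := by
  rw [← rampDeriv_of_nonpos (min_le_right t 0)]
  exact rampDeriv_mono (min_le_left t 0)

theorem rampDeriv_le_one (t : ℝ) : rampDeriv t ≤ 1 := by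
  rw [← rampDeriv_of_one_le (le_max_right t 1)]
  exact rampDeriv_mono (le_max_left t 1)

theorem hasDerivAt_ramp (t : ℝ) : HasDerivAt ramp (rampDeriv t) t := by
  have h := ((hasDerivAt_reluSq t).sub ((hasDerivAt_reluSq (t - 1)).comp_sub_const t 1)).div_const 2
  refine h.congr_deriv ?_
  rw [rampDeriv]; ring

theorem hasDerivAt_bspline (t : ℝ) : HasDerivAt bspline (bsplineDeriv t) t :=
  ((hasDerivAt_ramp t).sub (((hasDerivAt_ramp (t - 1)).comp_sub_const t 1).const_mul 2)).add
    ((hasDerivAt_ramp (t - 2)).comp_sub_const t 2)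

theorem bspline_eq_zero {t : ℝ} (ht : t ≤ 0 ∨ 3 ≤ t) : bspline t = 0 := by
  rcases ht with h | h
  · rw [bspline, ramp_of_nonpos h, ramp_of_nonpos (by linarith), ramp_of_nonpos (by linarith)]
    ring
  · rw [bspline, ramp_of_one_le (by linarith), ramp_of_one_le (by linarith),
      ramp_of_one_le (by linarith)]
    ring

theorem bsplineDeriv_eq_zero {t : ℝ} (ht : t ≤ 0 ∨ 3 ≤ t) : bsplineDeriv t = 0 := by
  rcases ht with h | h
  · rw [bsplineDeriv, rampDeriv_of_nonpos h, rampDeriv_of_nonpos (by linarith),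
      rampDeriv_of_nonpos (by linarith)]
    ring
  · rw [bsplineDeriv, rampDeriv_of_one_le (by linarith), rampDeriv_of_one_le (by linarith),
      rampDeriv_of_one_le (by linarith)]
    ring

theorem bspline_nonneg (t : ℝ) : 0 ≤ bspline t := by
  simp only [bspline, ramp, reluSq]
  rcases le_total t 0 with h0 | h0
  · have := bspline_eq_zero (Or.inl h0)
    simp only [bspline, ramp, reluSq] at this
    exact this.ge
  rcases le_total t 3 with h3 | h3
  swap
  · have := bspline_eq_zero (Or.inr h3)
    simp only [bspline, ramp, reluSq] at this
    exact this.ge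
  rw [max_eq_right h0, max_eq_left (show t - 2 - 1 ≤ 0 by linarith),
    show t - 1 - 1 = t - 2 by ring]
  rcases le_total t 1 with h1 | h1
  · rw [max_eq_left (show t - 1 ≤ 0 by linarith), max_eq_left (show t - 2 ≤ 0 by linarith)]
    nlinarith [sq_nonneg t]
  rw [max_eq_right (show 0 ≤ t - 1 by linarith)]
  rcases le_total t 2 with h2 | h2
  · rw [max_eq_left (show t - 2 ≤ 0 by linarith)]
    nlinarith [mul_nonneg (sub_nonneg.2 h1) (sub_nonneg.2 h2)]
  · rw [max_eq_right (show 0 ≤ t - 2 by linarith)]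
    nlinarith [sq_nonneg (t - 3)]

theorem abs_bsplineDeriv_le (t : ℝ) : |bsplineDeriv t| ≤ rampDeriv t - rampDeriv (t - 2) := by
  have h1 := rampDeriv_mono (show t - 1 ≤ t by linarith)
  have h2 := rampDeriv_mono (show t - 2 ≤ t - 1 by linarith)
  rw [bsplineDeriv, abs_le]
  constructor <;> linarith

theorem sum_range_second_difference (e : ℕ → ℝ) (N : ℕ) :
    ∑ k ∈ Finset.range N, (e k - 2 * e (k + 1) + e (k + 2)) = e 0 - e 1 - e N + e (N + 1) := by
  induction N with
  | zero => simp
  | succ N ih => rw [Finset.sum_range_succ, ih]; ring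

theorem sum_range_mul_second_difference (e : ℕ → ℝ) (N : ℕ) :
    ∑ k ∈ Finset.range N, (k : ℝ) * (e k - 2 * e (k + 1) + e (k + 2)) =
      e 1 - e (N + 1) - N * (e N - e (N + 1)) := by
  induction N with
  | zero => simp
  | succ N ih => rw [Finset.sum_range_succ, ih]; push_cast; ring

section Univariate

variable (n : ℕ)

/-- The `k`-th of the `n + 2` quadratic B-splines with mesh width `1 / n` that do not vanish
identically on `(0, 1)`. -/
noncomputable def spline (k : Fin (n + 2)) (x : ℝ) : ℝ := bspline (n * x + 2 - (k : ℝ))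

/-- The derivative of `spline n k`. -/
noncomputable def splineDeriv (k : Fin (n + 2)) (x : ℝ) : ℝ :=
  n * bsplineDeriv (n * x + 2 - (k : ℝ))

/-- The midpoint of the support of `spline n k`. -/
noncomputable def node (k : Fin (n + 2)) : ℝ := ((k : ℝ) - 1 / 2) / n

theorem hasDerivAt_spline (k : Fin (n + 2)) (x : ℝ) :
    HasDerivAt (spline n k) (splineDeriv n k x) x := by
  have h : HasDerivAt (fun x : ℝ => n * x + 2 - (k : ℝ)) (n * 1) x :=
    (((hasDerivAt_id x).const_mul (n : ℝ)).add_const 2).sub_const _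
  refine ((hasDerivAt_bspline _).comp x h).congr_deriv ?_
  rw [splineDeriv]; ring

theorem spline_nonneg (k : Fin (n + 2)) (x : ℝ) : 0 ≤ spline n k x := bspline_nonneg _

variable {n} {x : ℝ}

theorem sum_fin_second_difference {e : ℝ → ℝ} (t : ℝ) :
    ∑ k : Fin (n + 2), (e (t + 2 - (k : ℝ)) - 2 * e (t + 2 - (k : ℝ) - 1) +
      e (t + 2 - (k : ℝ) - 2)) = e (t + 2) - e (t + 1) - e (t - n) + e (t - n - 1) := by
  have h := sum_range_second_difference (fun k => e (t + 2 - k)) (n + 2)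
  rw [← Fin.sum_univ_eq_sum_range] at h
  convert h using 1
  · refine Finset.sum_congr rfl fun k _ => ?_
    push_cast
    ring_nf
  · push_cast
    ring_nf

theorem sum_fin_mul_second_difference {e : ℝ → ℝ} (t : ℝ) :
    ∑ k : Fin (n + 2), (k : ℝ) * (e (t + 2 - (k : ℝ)) - 2 * e (t + 2 - (k : ℝ) - 1) +
      e (t + 2 - (k : ℝ) - 2)) =
      e (t + 1) - e (t - n - 1) - (n + 2) * (e (t - n) - e (t - n - 1)) := by
  have h := sum_range_mul_second_difference (fun k => e (t + 2 - k)) (n + 2)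
  rw [← Fin.sum_univ_eq_sum_range
    (fun k => (k : ℝ) * (e (t + 2 - k) - 2 * e (t + 2 - (k + 1 : ℕ)) +
      e (t + 2 - (k + 2 : ℕ))))] at h
  convert h using 1
  · refine Finset.sum_congr rfl fun k _ => ?_
    push_cast
    ring_nf
  · push_cast
    ring_nf

theorem sum_spline (h0 : 0 ≤ x) (h1 : x ≤ 1) : ∑ k, spline n k x = 1 := by
  have hn : n * x ≤ n := mul_le_of_le_one_right (Nat.cast_nonneg n) h1
  have hn0 : 0 ≤ n * x := by positivity
  simp only [spline, bspline]
  rw [sum_fin_second_difference, ramp_of_one_le (by linarith), ramp_of_one_le (by linarith),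
    ramp_of_nonpos (by linarith), ramp_of_nonpos (by linarith)]
  ring

theorem sum_node_mul_spline (hn : n ≠ 0) (h0 : 0 ≤ x) (h1 : x ≤ 1) :
    ∑ k, node n k * spline n k x = x := by
  have hx : n * x ≤ n := mul_le_of_le_one_right (Nat.cast_nonneg n) h1
  have hx0 : 0 ≤ n * x := by positivity
  have h := sum_spline (n := n) h0 h1
  have h' : ∑ k : Fin (n + 2), (k : ℝ) * spline n k x = n * x + 1 / 2 := by
    simp only [spline, bspline]
    rw [sum_fin_mul_second_difference, ramp_of_one_le (by linarith),
      ramp_of_nonpos (by linarith), ramp_of_nonpos (by linarith)]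
    ring
  have e : ∀ k, node n k * spline n k x = ((k : ℝ) * spline n k x - 1 / 2 * spline n k x) / n :=
    fun k => by rw [node]; ring
  rw [Finset.sum_congr rfl fun k _ => e k, ← Finset.sum_div, Finset.sum_sub_distrib,
    ← Finset.mul_sum, h, h']
  have : (n : ℝ) ≠ 0 := by exact_mod_cast hn
  field_simp
  ring

theorem sum_splineDeriv (h0 : 0 ≤ x) (h1 : x ≤ 1) : ∑ k, splineDeriv n k x = 0 := by
  have hn : n * x ≤ n := mul_le_of_le_one_right (Nat.cast_nonneg n) h1
  have hn0 : 0 ≤ n * x := by positivity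
  simp only [splineDeriv, bsplineDeriv]
  rw [← Finset.mul_sum, sum_fin_second_difference, rampDeriv_of_one_le (by linarith),
    rampDeriv_of_one_le (by linarith), rampDeriv_of_nonpos (by linarith),
    rampDeriv_of_nonpos (by linarith)]
  ring

theorem sum_node_mul_splineDeriv (hn : n ≠ 0) (h0 : 0 ≤ x) (h1 : x ≤ 1) :
    ∑ k, node n k * splineDeriv n k x = 1 := by
  have hx : n * x ≤ n := mul_le_of_le_one_right (Nat.cast_nonneg n) h1
  have hx0 : 0 ≤ n * x := by positivity
  have hn' : (n : ℝ) ≠ 0 := by exact_mod_cast hn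
  have h := sum_splineDeriv (n := n) h0 h1
  have h' : ∑ k : Fin (n + 2), (k : ℝ) * bsplineDeriv (n * x + 2 - (k : ℝ)) = 1 := by
    simp only [bsplineDeriv]
    rw [sum_fin_mul_second_difference, rampDeriv_of_one_le (by linarith),
      rampDeriv_of_nonpos (by linarith), rampDeriv_of_nonpos (by linarith)]
    ring
  have e : ∀ k, node n k * splineDeriv n k x =
      (k : ℝ) * bsplineDeriv (n * x + 2 - (k : ℝ)) - 1 / 2 / n * splineDeriv n k x := fun k => by
    rw [node, splineDeriv]; field_simp
  rw [Finset.sum_congr rfl fun k _ => e k, Finset.sum_sub_distrib, ← Finset.mul_sum, h, h']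
  ring

theorem sum_abs_splineDeriv_le : ∑ k, |splineDeriv n k x| ≤ 2 * n := by
  have h : ∀ k : Fin (n + 2), |splineDeriv n k x| ≤
      n * (rampDeriv (n * x + 2 - (k : ℝ)) - rampDeriv (n * x + 2 - (k + 2 : ℕ))) := fun k => by
    rw [splineDeriv, abs_mul, Nat.abs_cast]
    have h := abs_bsplineDeriv_le (n * x + 2 - (k : ℝ))
    rw [show n * x + 2 - (k : ℝ) - 2 = n * x + 2 - (k + 2 : ℕ) by push_cast; ring] at h
    gcongr
  refine (Finset.sum_le_sum fun k _ => h k).trans ?_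
  have htel : ∀ (a : ℕ → ℝ) (N : ℕ), ∑ k ∈ Finset.range N, (a k - a (k + 2)) =
      a 0 + a 1 - a N - a (N + 1) := by
    intro a N
    induction N with
    | zero => simp
    | succ N ih => rw [Finset.sum_range_succ, ih]; ring
  rw [← Finset.mul_sum, mul_comm, Fin.sum_univ_eq_sum_range
    (fun k => rampDeriv (n * x + 2 - (k : ℝ)) - rampDeriv (n * x + 2 - (k + 2 : ℕ))),
    htel fun k => rampDeriv (n * x + 2 - k)]
  gcongr
  linarith [rampDeriv_le_one (n * x + 2 - (0 : ℕ)), rampDeriv_le_one (n * x + 2 - (1 : ℕ)),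
    rampDeriv_nonneg (n * x + 2 - (n + 2 : ℕ)), rampDeriv_nonneg (n * x + 2 - (n + 2 + 1 : ℕ))]

theorem abs_node_sub_le (hn : n ≠ 0) {k : Fin (n + 2)}
    (h : spline n k x ≠ 0 ∨ splineDeriv n k x ≠ 0) : |node n k - x| ≤ 3 / 2 / n := by
  have hn' : (0 : ℝ) < n := by positivity
  have h1 : ¬ (n * x + 2 - (k : ℝ) ≤ 0 ∨ 3 ≤ n * x + 2 - (k : ℝ)) := by
    intro hc
    rcases h with h | h
    · exact h (bspline_eq_zero hc)
    · exact h (by rw [splineDeriv, bsplineDeriv_eq_zero hc, mul_zero])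
  push Not at h1
  have e : node n k - x = ((k : ℝ) - 1 / 2 - n * x) / n := by rw [node]; field_simp
  rw [e, abs_div, abs_of_pos hn']
  gcongr
  rw [abs_le]
  constructor <;> linarith

end Univariate

/-! ### Tensor products of splines -/

section Tensor

variable {d n : ℕ}

/-- The tensor product of the univariate splines with the given indices. -/
noncomputable def tensorSpline (p : Fin d → Fin (n + 2)) (x : Fin d → ℝ) : ℝ :=
  ∏ j, spline n (p j) (x j)

/-- The partial derivative of `tensorSpline p` in the direction `l`. -/
noncomputable def tensorSplineDeriv (l : Fin d) (p : Fin d → Fin (n + 2)) (x : Fin d → ℝ) : ℝ :=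
  ∏ j, if j = l then splineDeriv n (p j) (x j) else spline n (p j) (x j)

theorem hasFDerivAt_tensorSpline (p : Fin d → Fin (n + 2)) (x : Fin d → ℝ) :
    ∃ F : (Fin d → ℝ) →L[ℝ] ℝ, HasFDerivAt (tensorSpline p) F x ∧
      ∀ l, F (Pi.single l 1) = tensorSplineDeriv l p x := by
  have h : ∀ j ∈ Finset.univ, HasFDerivAt (fun x : Fin d → ℝ => spline n (p j) (x j))
      (splineDeriv n (p j) (x j) •
        ContinuousLinearMap.proj (R := ℝ) (φ := fun _ : Fin d => ℝ) j) x :=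
    fun j _ => HasDerivAt.comp_hasFDerivAt (h₂ := spline n (p j)) (f := fun x : Fin d → ℝ => x j) x
      (hasDerivAt_spline n (p j) (x j))
      (ContinuousLinearMap.proj (R := ℝ) (φ := fun _ : Fin d => ℝ) j).hasFDerivAt
  refine ⟨_, HasFDerivAt.finsetProd h, fun l => ?_⟩
  rw [sum_apply, Finset.sum_eq_single l, tensorSplineDeriv,
    ← Finset.mul_prod_erase _ _ (Finset.mem_univ l)]
  · simp only [smul_apply, ContinuousLinearMap.proj_apply, Pi.single_eq_same,
      smul_eq_mul, mul_one, if_true]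
    rw [mul_comm]
    congr 1
    refine Finset.prod_congr rfl fun j hj => ?_
    rw [if_neg (Finset.ne_of_mem_erase hj)]
  · intro j _ hj
    simp [hj]
  · simp

theorem sum_prod_eq (a : Fin d → Fin (n + 2) → ℝ) :
    ∑ p : Fin d → Fin (n + 2), ∏ j, a j (p j) = ∏ j, ∑ k, a j k := by
  rw [Finset.prod_univ_sum, Fintype.piFinset_univ]

theorem sum_mul_prod_eq (a : Fin d → Fin (n + 2) → ℝ) (m : Fin (n + 2) → ℝ) (r : Fin d) :
    ∑ p : Fin d → Fin (n + 2), m (p r) * ∏ j, a j (p j) =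
      (∑ k, m k * a r k) * ∏ j ∈ Finset.univ.erase r, ∑ k, a j k := by
  have h := sum_prod_eq (fun j k => (if j = r then m k else 1) * a j k)
  rw [← Finset.mul_prod_erase _ _ (Finset.mem_univ r)] at h
  simp only [if_true] at h
  rw [Finset.prod_congr rfl (g := fun j => ∑ k, a j k)] at h
  · rw [← h]
    refine Finset.sum_congr rfl fun p _ => ?_
    rw [Finset.prod_mul_distrib, Finset.prod_ite_eq' _ _ (fun j => m (p j)),
      if_pos (Finset.mem_univ r)]
  · intro j hj
    simp [Finset.ne_of_mem_erase hj]

variable {x : Fin d → ℝ}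

theorem sum_tensorSpline (hx : x ∈ cube d) :
    ∑ p : Fin d → Fin (n + 2), tensorSpline p x = 1 := by
  simp only [tensorSpline]
  rw [sum_prod_eq (fun j k => spline n k (x j))]
  exact Finset.prod_eq_one fun j _ => sum_spline (hx j).1.le (hx j).2.le

theorem sum_node_mul_tensorSpline (hn : n ≠ 0) (hx : x ∈ cube d) (r : Fin d) :
    ∑ p : Fin d → Fin (n + 2), node n (p r) * tensorSpline p x = x r := by
  simp only [tensorSpline]
  rw [sum_mul_prod_eq (fun j k => spline n k (x j)) (node n) r,
    sum_node_mul_spline hn (hx r).1.le (hx r).2.le, Finset.prod_eq_one, mul_one]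
  exact fun j _ => sum_spline (hx j).1.le (hx j).2.le

theorem sum_tensorSplineDeriv (hx : x ∈ cube d) (l : Fin d) :
    ∑ p : Fin d → Fin (n + 2), tensorSplineDeriv l p x = 0 := by
  simp only [tensorSplineDeriv]
  rw [sum_prod_eq (fun j k => if j = l then splineDeriv n k (x j) else spline n k (x j))]
  refine Finset.prod_eq_zero (Finset.mem_univ l) ?_
  simpa using sum_splineDeriv (n := n) (hx l).1.le (hx l).2.le

theorem sum_node_mul_tensorSplineDeriv (hn : n ≠ 0) (hx : x ∈ cube d) (l r : Fin d) :
    ∑ p : Fin d → Fin (n + 2), node n (p r) * tensorSplineDeriv l p x = if r = l then 1 else 0 := by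
  simp only [tensorSplineDeriv]
  rw [sum_mul_prod_eq (fun j k => if j = l then splineDeriv n k (x j) else spline n k (x j))
    (node n) r]
  by_cases h : r = l
  · subst h
    simp only [if_true]
    rw [sum_node_mul_splineDeriv hn (hx r).1.le (hx r).2.le, Finset.prod_eq_one, mul_one]
    intro j hj
    simpa [Finset.ne_of_mem_erase hj] using sum_spline (n := n) (hx j).1.le (hx j).2.le
  · rw [if_neg h, Finset.prod_eq_zero (i := l), mul_zero]
    · simpa using Ne.symm h
    · simpa using sum_splineDeriv (n := n) (hx l).1.le (hx l).2.le

theorem tensorSpline_nonneg (p : Fin d → Fin (n + 2)) (x : Fin d → ℝ) : 0 ≤ tensorSpline p x :=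
  Finset.prod_nonneg fun _ _ => spline_nonneg n _ _

theorem sum_abs_tensorSplineDeriv_le (hx : x ∈ cube d) (l : Fin d) :
    ∑ p : Fin d → Fin (n + 2), |tensorSplineDeriv l p x| ≤ 2 * n := by
  simp only [tensorSplineDeriv, Finset.abs_prod]
  rw [sum_prod_eq (fun j k => |if j = l then splineDeriv n k (x j) else spline n k (x j)|),
    ← Finset.mul_prod_erase _ _ (Finset.mem_univ l), Finset.prod_eq_one, mul_one]
  · simpa using sum_abs_splineDeriv_le (n := n)
  · intro j hj
    simp only [Finset.ne_of_mem_erase hj, if_false, abs_of_nonneg (spline_nonneg n _ _)]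
    exact sum_spline (hx j).1.le (hx j).2.le

/-- Only splines with a node near `x` contribute at `x`. -/
theorem abs_node_sub_le_of_tensorSpline (hn : n ≠ 0) {p : Fin d → Fin (n + 2)}
    (h : tensorSpline p x ≠ 0 ∨ ∃ l, tensorSplineDeriv l p x ≠ 0) (j : Fin d) :
    |node n (p j) - x j| ≤ 3 / 2 / n := by
  refine abs_node_sub_le hn ?_
  rcases h with h | ⟨l, h⟩
  · exact Or.inl (Finset.prod_ne_zero_iff.1 h j (Finset.mem_univ j))
  · have := Finset.prod_ne_zero_iff.1 h j (Finset.mem_univ j)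
    by_cases hj : j = l
    · rw [if_pos hj] at this
      exact Or.inr this
    · rw [if_neg hj] at this
      exact Or.inl this

/-- The weights of `ReLU²` in the truncated power representation of `bspline`. -/
noncomputable def bsplineCoeff : Fin 4 → ℝ := ![1 / 2, -3 / 2, 3 / 2, -1 / 2]

theorem bspline_eq_sum (t : ℝ) :
    bspline t = ∑ r : Fin 4, bsplineCoeff r * reluSq (t - (r : ℝ)) := by
  simp only [Fin.sum_univ_four, bsplineCoeff, bspline, ramp, Matrix.cons_val]
  norm_num
  rw [show t - 1 - 1 = t - 2 by ring, show t - 2 - 1 = t - 3 by ring]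
  ring

/-- Linear combinations of tensor product splines are network functions: the first hidden layer
contains the truncated powers, the others multiply the univariate factors. -/
theorem isNet_sum_tensorSpline (c : (Fin d → Fin (n + 2)) → ℝ) (hd : 1 ≤ d) :
    IsNet (Nat.clog 2 d + 2) (4 * d * (n + 2) ^ d) (fun x => ∑ p, c p * tensorSpline p x) := by
  let κ := Fin d × Fin (n + 2) × Fin 4
  have h := isNet_sum_prod_reluSq (κ := κ) c
    (fun p j q => if q.1 = j ∧ q.2.1 = p j then bsplineCoeff q.2.2 else 0)
    (fun q l => if l = q.1 then (n : ℝ) else 0) (fun q => 2 - (q.2.1 : ℝ) - (q.2.2 : ℝ))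
  have hN : 1 ≤ (n + 2) ^ d := Nat.one_le_pow _ _ (by omega)
  have hW : max (max d 1) (max (Fintype.card κ)
      (2 * Fintype.card (Fin d → Fin (n + 2)) * 2 ^ Nat.clog 2 d)) ≤ 4 * d * (n + 2) ^ d := by
    simp only [κ, Fintype.card_prod, Fintype.card_fin, Fintype.card_fun]
    have h1 : n + 2 ≤ (n + 2) ^ d := Nat.le_self_pow (by omega) _
    have h2 : 2 ^ Nat.clog 2 d ≤ 2 * d := by
      rcases hd.eq_or_lt with rfl | h
      · simp
      · have := Nat.pow_pred_clog_lt_self (b := 2) (by norm_num) (show 1 < d from h)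
        have h3 : Nat.clog 2 d = (Nat.clog 2 d).pred + 1 :=
          (Nat.succ_pred_eq_of_pos (Nat.clog_pos (by norm_num) h)).symm
        rw [h3, pow_succ]
        omega
    have h4 : d ≤ 4 * d * (n + 2) ^ d := by nlinarith
    refine max_le (max_le h4 (by omega)) (max_le ?_ ?_)
    · calc d * ((n + 2) * 4) = 4 * d * (n + 2) := by ring
        _ ≤ _ := Nat.mul_le_mul_left _ h1
    · calc 2 * (n + 2) ^ d * 2 ^ Nat.clog 2 d ≤ 2 * (n + 2) ^ d * (2 * d) :=
          Nat.mul_le_mul_left _ h2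
        _ = _ := by ring
  convert h.mono hW using 2 with x
  refine Finset.sum_congr rfl fun p _ => ?_
  congr 1
  refine Finset.prod_congr rfl fun j _ => ?_
  rw [spline, bspline_eq_sum]
  symm
  change ∑ q : Fin d × Fin (n + 2) × Fin 4, _ = _
  rw [Fintype.sum_prod_type, Finset.sum_eq_single j, Fintype.sum_prod_type,
    Finset.sum_eq_single (p j)]
  · refine Finset.sum_congr rfl fun r _ => ?_
    simp only [and_self, if_true, ite_mul, zero_mul, Finset.sum_ite_eq', Finset.mem_univ]
    congr 2
    ring
  · intro k _ hk
    simp [hk]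
  · simp
  · intro i _ hi
    simp [hi]
  · simp

end Tensor

/-! ### An averaged Taylor estimate -/

section Taylor

variable {d : ℕ}

theorem fderiv_apply_eq_sum (f : (Fin d → ℝ) → ℝ) (x v : Fin d → ℝ) :
    fderiv ℝ f x v = ∑ i, partialDeriv i f x * v i := by
  conv_lhs => rw [pi_eq_sum_univ' v]
  rw [map_sum]
  refine Finset.sum_congr rfl fun i _ => ?_
  rw [map_smul, smul_eq_mul, mul_comm, partialDeriv]

theorem hasDerivAt_comp_segment {f : (Fin d → ℝ) → ℝ} (hf : Differentiable ℝ f)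
    (x y : Fin d → ℝ) (t : ℝ) :
    HasDerivAt (fun t => f (x + t • y)) (∑ i, partialDeriv i f (x + t • y) * y i) t := by
  have h : HasDerivAt (fun t : ℝ => x + t • y) y t := by
    simpa using ((hasDerivAt_id t).smul_const y).const_add x
  rw [← fderiv_apply_eq_sum]
  exact (hf (x + t • y)).hasFDerivAt.comp_hasDerivAt t h

/-- The sum of the absolute values of the second partial derivatives. -/
noncomputable def hessSum (f : (Fin d → ℝ) → ℝ) (x : Fin d → ℝ) : ℝ :=
  ∑ i, ∑ j, |partialDeriv i (partialDeriv j f) x|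

theorem _root_.ContDiff.partialDeriv_infty {f : (Fin d → ℝ) → ℝ} (hf : ContDiff ℝ ∞ f)
    (i : Fin d) : ContDiff ℝ ∞ (partialDeriv i f) :=
  (hf.fderiv_right (m := ∞) (by simp)).clm_apply contDiff_const

theorem continuous_hessSum {f : (Fin d → ℝ) → ℝ} (hf : ContDiff ℝ ∞ f) :
    Continuous (hessSum f) :=
  continuous_finsetSum _ fun i _ => continuous_finsetSum _ fun j _ =>
    (((hf.partialDeriv_infty j).partialDeriv_infty i).continuous).abs

theorem hessSum_nonneg (f : (Fin d → ℝ) → ℝ) (x : Fin d → ℝ) : 0 ≤ hessSum f x :=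
  Finset.sum_nonneg fun _ _ => Finset.sum_nonneg fun _ _ => abs_nonneg _

/-- Taylor's formula of first order, with a bound for the integral remainder. -/
theorem abs_taylor_le {f : (Fin d → ℝ) → ℝ} (hf : ContDiff ℝ ∞ f) (x y : Fin d → ℝ) {δ : ℝ}
    (hy : ∀ i, |y i| ≤ δ) : |f (x + y) - f x - ∑ i, partialDeriv i f x * y i| ≤
      ∫ t in (0 : ℝ)..1, δ ^ 2 * hessSum f (x + t • y) := by
  let g : ℝ → ℝ := fun t => ∑ i, partialDeriv i f (x + t • y) * y i
  let g' : ℝ → ℝ := fun t => ∑ i, (∑ j, partialDeriv j (partialDeriv i f) (x + t • y) * y j) * y i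
  have hc : Continuous fun t : ℝ => x + t • y := by fun_prop
  have hg : ∀ t, HasDerivAt g (g' t) t := fun t =>
    HasDerivAt.fun_sum fun i _ => (hasDerivAt_comp_segment
      ((hf.partialDeriv_infty i).differentiable (by simp)) x y t).mul_const (y i)
  have hg'c : Continuous g' := continuous_finsetSum _ fun i _ => (continuous_finsetSum _ fun j _ =>
    ((((hf.partialDeriv_infty i).partialDeriv_infty j).continuous.comp hc).mul
      continuous_const)).mul continuous_const
  have hder : ∀ t ∈ Set.uIcc (0 : ℝ) 1, HasDerivAt (fun t => f (x + t • y) + (1 - t) * g t)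
      ((1 - t) * g' t) t := fun t _ => by
    refine ((hasDerivAt_comp_segment (hf.differentiable (by simp)) x y t).add
      (((hasDerivAt_id t).const_sub 1).mul (hg t))).congr_deriv ?_
    simp only [g, id]
    ring
  have hint := intervalIntegral.integral_eq_sub_of_hasDerivAt hder
    ((continuous_const.sub continuous_id).mul hg'c |>.intervalIntegrable 0 1)
  have e : f (x + y) - f x - ∑ i, partialDeriv i f x * y i = ∫ t in (0 : ℝ)..1, (1 - t) * g' t := by
    rw [hint]
    simp [g]
    ring
  rw [e, ← Real.norm_eq_abs]
  refine intervalIntegral.norm_integral_le_of_norm_le zero_le_one ?_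
    ((continuous_const.mul ((continuous_hessSum hf).comp hc)).intervalIntegrable 0 1)
  refine Filter.Eventually.of_forall fun t ht => ?_
  have hδ : ∀ i, 0 ≤ δ := fun i => (abs_nonneg _).trans (hy i)
  have h1 : |g' t| ≤ δ ^ 2 * hessSum f (x + t • y) := by
    rw [hessSum, Finset.sum_comm, Finset.mul_sum]
    refine (Finset.abs_sum_le_sum_abs _ _).trans (Finset.sum_le_sum fun i _ => ?_)
    rw [abs_mul]
    have h2 : |∑ j, partialDeriv j (partialDeriv i f) (x + t • y) * y j| ≤
        δ * ∑ j, |partialDeriv j (partialDeriv i f) (x + t • y)| := by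
      rw [Finset.mul_sum]
      refine (Finset.abs_sum_le_sum_abs _ _).trans (Finset.sum_le_sum fun j _ => ?_)
      rw [abs_mul, mul_comm]
      exact mul_le_mul_of_nonneg_right (hy j) (abs_nonneg _)
    calc _ ≤ (δ * ∑ j, |partialDeriv j (partialDeriv i f) (x + t • y)|) * δ :=
          mul_le_mul h2 (hy i) (abs_nonneg _)
            (mul_nonneg (hδ i) (Finset.sum_nonneg fun _ _ => abs_nonneg _))
      _ = _ := by ring
  rw [Real.norm_eq_abs, abs_mul, abs_of_nonneg (by linarith [ht.2])]
  exact (mul_le_of_le_one_left (abs_nonneg _) (by linarith [ht.1])).trans h1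

/-- The mean of `f` over the cube with centre `m` and side `1 / (2 n)`. -/
noncomputable def boxMean (n : ℕ) (f : (Fin d → ℝ) → ℝ) (m : Fin d → ℝ) : ℝ :=
  (2 * n) ^ d * ∫ z in Metric.closedBall m (1 / (4 * n)), f z

theorem volume_box {n : ℕ} (hn : n ≠ 0) (m : Fin d → ℝ) :
    volume (Metric.closedBall m (1 / (4 * n))) = ENNReal.ofReal ((1 / (2 * n)) ^ d) := by
  rw [Real.volume_pi_closedBall _ (by positivity), Fintype.card_fin]
  congr 2
  field_simp
  norm_num

theorem setIntegral_closedBall_sub_eq_zero (m : Fin d → ℝ) (r : ℝ) (i : Fin d) :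
    ∫ z in Metric.closedBall m r, (z i - m i) = 0 := by
  rw [← integral_indicator Metric.isClosed_closedBall.measurableSet]
  have h := integral_sub_left_eq_self
    ((Metric.closedBall m r).indicator fun z => z i - m i) volume ((2 : ℝ) • m)
  have e : ∀ z, (Metric.closedBall m r).indicator (fun z => z i - m i) ((2 : ℝ) • m - z) =
      - (Metric.closedBall m r).indicator (fun z => z i - m i) z := by
    intro z
    have hz : ((2 : ℝ) • m - z ∈ Metric.closedBall m r) ↔ z ∈ Metric.closedBall m r := by
      rw [Metric.mem_closedBall, Metric.mem_closedBall, dist_eq_norm, dist_eq_norm,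
        ← norm_neg, two_smul]
      congr! 2
      abel
    by_cases h : z ∈ Metric.closedBall m r
    · rw [Set.indicator_of_mem h, Set.indicator_of_mem (hz.2 h)]
      simp; ring
    · rw [Set.indicator_of_notMem h, Set.indicator_of_notMem (fun h' => h (hz.1 h')), neg_zero]
  simp only [e, integral_neg] at h
  linarith

/-- The mean over a box reproduces affine functions, up to an integral of the remainder. -/
theorem boxMean_sub_eq {n : ℕ} (hn : n ≠ 0) {f : (Fin d → ℝ) → ℝ} (hf : Continuous f)
    (m x : Fin d → ℝ) (a : Fin d → ℝ) (b : ℝ) :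
    boxMean n f m - b - ∑ i, a i * (m i - x i) =
      boxMean n (fun z => f z - b - ∑ i, a i * (z i - x i)) m := by
  have hK : IsCompact (Metric.closedBall m (1 / (4 * (n : ℝ)))) := isCompact_closedBall _ _
  have hI : ∀ {g : (Fin d → ℝ) → ℝ}, Continuous g →
      IntegrableOn g (Metric.closedBall m (1 / (4 * (n : ℝ)))) :=
    fun hg => hg.continuousOn.integrableOn_compact hK
  have hv : (volume : Measure (Fin d → ℝ)).real (Metric.closedBall m (1 / (4 * n))) =
      (1 / (2 * n)) ^ d := by
    rw [Measure.real, volume_box hn, ENNReal.toReal_ofReal (by positivity)]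
  have hone : (2 * (n : ℝ)) ^ d * (1 / (2 * n)) ^ d = 1 := by
    rw [← mul_pow]
    have : (n : ℝ) ≠ 0 := by exact_mod_cast hn
    rw [mul_one_div_cancel (by positivity), one_pow]
  have hi : ∀ i, ∫ z in Metric.closedBall m (1 / (4 * (n : ℝ))), a i * (z i - x i) =
      (1 / (2 * n)) ^ d * (a i * (m i - x i)) := by
    intro i
    have e : ∀ z : Fin d → ℝ, a i * (z i - x i) = a i * (z i - m i) + a i * (m i - x i) :=
      fun z => by ring
    rw [integral_congr_ae (Filter.Eventually.of_forall e), integral_add (hI (by fun_prop))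
      (hI (by fun_prop)), integral_const_mul,
      setIntegral_closedBall_sub_eq_zero, setIntegral_const, hv, mul_zero, zero_add, smul_eq_mul]
  rw [boxMean, boxMean, integral_sub (hI (by fun_prop)) (hI (by fun_prop)),
    integral_sub (hI hf) (hI (by fun_prop)), integral_finsetSum _ fun i _ => hI (by fun_prop),
    setIntegral_const, hv, Finset.sum_congr rfl fun i _ => hi i, ← Finset.mul_sum, smul_eq_mul]
  linear_combination (b + ∑ i, a i * (m i - x i)) * hone

/-- The measure on pairs `(y, t)` over which second derivatives at `x + t y` are integrated. -/
noncomputable def segmentMeasure (d n : ℕ) : Measure ((Fin d → ℝ) × ℝ) :=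
  (volume.restrict (Metric.closedBall 0 (4 / n))).prod (volume.restrict (Set.Ioc 0 1))

instance (d n : ℕ) : SFinite (segmentMeasure d n) := by unfold segmentMeasure; infer_instance

theorem segmentMeasure_univ {n : ℕ} :
    segmentMeasure d n Set.univ = ENNReal.ofReal ((8 / n) ^ d) := by
  rw [segmentMeasure, ← Set.univ_prod_univ, Measure.prod_prod, Measure.restrict_apply_univ,
    Measure.restrict_apply_univ, Real.volume_pi_closedBall _ (by positivity), Real.volume_Ioc,
    Fintype.card_fin]
  simp
  ring_nf

/-- A local average of the second derivatives of `f`, taken within the unit cube. -/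
noncomputable def hessMean (n : ℕ) (f : (Fin d → ℝ) → ℝ) (x : Fin d → ℝ) : ℝ≥0∞ :=
  ENNReal.ofReal ((2 * n) ^ d) * ∫⁻ q, ENNReal.ofReal
    ((cube d).indicator (hessSum f) (x + q.2 • q.1)) ∂segmentMeasure d n

theorem measurable_indicator_hessSum {f : (Fin d → ℝ) → ℝ} (hf : ContDiff ℝ ∞ f) :
    Measurable fun x => ENNReal.ofReal ((cube d).indicator (hessSum f) x) :=
  ((continuous_hessSum hf).measurable.indicator (measurableSet_cube d)).ennreal_ofReal

theorem measurable_segment_hessSum {f : (Fin d → ℝ) → ℝ} (hf : ContDiff ℝ ∞ f) :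
    Measurable (Function.uncurry fun (x : Fin d → ℝ) (q : (Fin d → ℝ) × ℝ) =>
      ENNReal.ofReal ((cube d).indicator (hessSum f) (x + q.2 • q.1))) :=
  (measurable_indicator_hessSum hf).comp (by fun_prop)

theorem measurable_hessMean {n : ℕ} {f : (Fin d → ℝ) → ℝ} (hf : ContDiff ℝ ∞ f) :
    Measurable (hessMean n f) :=
  (measurable_segment_hessSum hf).lintegral_prod_right.const_mul _

theorem lintegral_sq_hessMean_le {n : ℕ} (hn : n ≠ 0) {f : (Fin d → ℝ) → ℝ}
    (hf : ContDiff ℝ ∞ f) :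
    ∫⁻ x, hessMean n f x ^ 2 ≤ ENNReal.ofReal (256 ^ d * normL2Sq (cube d) (hessSum f)) := by
  have hH : ∫⁻ x, ENNReal.ofReal ((cube d).indicator (hessSum f) x) ^ 2 =
      ENNReal.ofReal (normL2Sq (cube d) (hessSum f)) := by
    rw [← (MemL2.of_continuous (continuous_hessSum hf)).eLpNorm_sq, eLpNorm_two_sq,
      ← lintegral_indicator (measurableSet_cube d)]
    refine lintegral_congr fun x => ?_
    by_cases hx : x ∈ cube d
    · simp [hx, Real.enorm_of_nonneg (hessSum_nonneg f x)]
    · simp [hx]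
  have hm := measurable_segment_hessSum hf
  simp only [hessMean, mul_pow]
  rw [lintegral_const_mul _ (hm.lintegral_prod_right.pow_const 2)]
  refine (mul_le_mul_right (lintegral_sq_lintegral_le volume (segmentMeasure d n) hm) _).trans ?_
  simp only [lintegral_add_right_eq_self
    (fun x => ENNReal.ofReal ((cube d).indicator (hessSum f) x) ^ 2)]
  rw [hH, lintegral_const, segmentMeasure_univ, ← ENNReal.ofReal_pow (by positivity),
    ← ENNReal.ofReal_mul (normL2Sq_nonneg _ _), ← ENNReal.ofReal_mul (by positivity),
    ← ENNReal.ofReal_mul (by positivity)]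
  refine (congrArg ENNReal.ofReal ?_).le
  have h16 : (2 * (n : ℝ)) ^ d * (8 / n) ^ d = 16 ^ d := by
    rw [← mul_pow]
    have : (n : ℝ) ≠ 0 := by exact_mod_cast hn
    congr 1
    field_simp
    norm_num
  calc _ = ((2 * (n : ℝ)) ^ d * (8 / n) ^ d) ^ 2 * normL2Sq (cube d) (hessSum f) := by ring
    _ = _ := by rw [h16, ← pow_mul, mul_comm d 2, pow_mul]; norm_num

theorem convex_cube (d : ℕ) : Convex ℝ (cube d) := by
  rw [cube_eq_pi]
  exact convex_pi fun _ _ => convex_Ioo 0 1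

theorem ofReal_abs_boxMean_sub_le {n : ℕ} (hn : n ≠ 0) {f : (Fin d → ℝ) → ℝ}
    (hf : ContDiff ℝ ∞ f) {x m : Fin d → ℝ} (hx : x ∈ cube d)
    (hm : Metric.closedBall m (1 / (4 * n)) ⊆ cube d)
    (hmx : ∀ i, |m i - x i| ≤ 15 / 4 / n) :
    ENNReal.ofReal |boxMean n f m - f x - ∑ i, partialDeriv i f x * (m i - x i)| ≤
      ENNReal.ofReal (16 / n ^ 2) * hessMean n f x := by
  have hn' : (0 : ℝ) < n := by positivity
  have hclose : ∀ z ∈ Metric.closedBall m (1 / (4 * (n : ℝ))), ∀ i, |z i - x i| ≤ 4 / n := by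
    intro z hz i
    have h1 : |z i - m i| ≤ 1 / (4 * n) := (dist_le_pi_dist z m i).trans hz
    have h2 : |z i - x i| ≤ |z i - m i| + |m i - x i| := by
      have := abs_add_le (z i - m i) (m i - x i)
      simpa using this
    calc _ ≤ 1 / (4 * (n : ℝ)) + 15 / 4 / n := by linarith [hmx i]
      _ = 4 / n := by field_simp; norm_num
  rw [boxMean_sub_eq hn hf.continuous, boxMean, abs_mul, abs_of_nonneg (by positivity),
    ENNReal.ofReal_mul (by positivity), hessMean, mul_left_comm]
  gcongr
  rw [← Real.norm_eq_abs, ofReal_norm]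
  refine (enorm_integral_le_lintegral_enorm _).trans ?_
  let F : (Fin d → ℝ) → ℝ≥0∞ := fun y => ∫⁻ t in Set.Ioc (0 : ℝ) 1,
    ENNReal.ofReal ((cube d).indicator (hessSum f) (x + t • y))
  have hpt : ∀ z ∈ Metric.closedBall m (1 / (4 * (n : ℝ))),
      ‖f z - f x - ∑ i, partialDeriv i f x * (z i - x i)‖ₑ ≤
        ENNReal.ofReal (16 / n ^ 2) * F (z - x) := by
    intro z hz
    have h := abs_taylor_le hf x (z - x) (δ := 4 / n) (hclose z hz)
    rw [add_sub_cancel, intervalIntegral.integral_const_mul] at h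
    have hc : Continuous fun t : ℝ => hessSum f (x + t • (z - x)) :=
      (continuous_hessSum hf).comp (by fun_prop)
    rw [← ofReal_norm, Real.norm_eq_abs]
    refine (ENNReal.ofReal_le_ofReal h).trans ?_
    rw [ENNReal.ofReal_mul (by positivity), show ((4 : ℝ) / n) ^ 2 = 16 / n ^ 2 by
      rw [div_pow]; norm_num]
    gcongr
    rw [intervalIntegral.integral_of_le zero_le_one, ofReal_integral_eq_lintegral_ofReal
      (hc.integrableOn_Ioc) (Filter.Eventually.of_forall fun t => hessSum_nonneg _ _)]
    refine setLIntegral_mono' measurableSet_Ioc fun t ht => ?_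
    rw [Set.indicator_of_mem]
    have := (convex_cube d).add_smul_sub_mem hx (hm hz) ⟨ht.1.le, ht.2⟩
    exact this
  refine (setLIntegral_mono' Metric.isClosed_closedBall.measurableSet hpt).trans ?_
  have hmeas : Measurable (Function.uncurry fun (y : Fin d → ℝ) (t : ℝ) =>
      ENNReal.ofReal ((cube d).indicator (hessSum f) (x + t • y))) :=
    (measurable_indicator_hessSum hf).comp (by fun_prop)
  have hF : Measurable F := hmeas.lintegral_prod_right
  rw [lintegral_const_mul _ (f := fun z => F (z - x)) (by fun_prop), segmentMeasure,
    lintegral_prod (fun q : (Fin d → ℝ) × ℝ =>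
      ENNReal.ofReal ((cube d).indicator (hessSum f) (x + q.2 • q.1))) hmeas.aemeasurable]
  refine mul_le_mul_right ?_ _
  change _ ≤ ∫⁻ y in Metric.closedBall 0 (4 / (n : ℝ)), F y
  -- the box is contained in a translate of the domain of integration of `hessMean`
  rw [← lintegral_indicator Metric.isClosed_closedBall.measurableSet,
    ← lintegral_indicator Metric.isClosed_closedBall.measurableSet,
    ← lintegral_sub_right_eq_self ((Metric.closedBall 0 (4 / (n : ℝ))).indicator F) x]
  refine lintegral_mono fun z => ?_
  by_cases hz : z ∈ Metric.closedBall m (1 / (4 * (n : ℝ)))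
  · rw [Set.indicator_of_mem hz, Set.indicator_of_mem]
    rw [mem_closedBall_zero_iff, pi_norm_le_iff_of_nonneg (by positivity)]
    exact hclose z hz
  · rw [Set.indicator_of_notMem hz]
    exact zero_le

theorem hessMean_le {n : ℕ} {f : (Fin d → ℝ) → ℝ} (hf : ContDiff ℝ ∞ f) :
    ∃ B : ℝ≥0∞, B ≠ ⊤ ∧ ∀ x, hessMean n f x ≤ B := by
  obtain ⟨B, hB⟩ := (continuous_hessSum hf).exists_abs_le_cube
  refine ⟨ENNReal.ofReal ((2 * n) ^ d) * (ENNReal.ofReal B * ENNReal.ofReal ((8 / n) ^ d)),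
    by finiteness, fun x => ?_⟩
  rw [hessMean, ← segmentMeasure_univ, ← lintegral_const]
  refine mul_le_mul_right (lintegral_mono fun q => ?_) _
  by_cases hq : x + q.2 • q.1 ∈ cube d
  · rw [Set.indicator_of_mem hq]
    exact ENNReal.ofReal_le_ofReal ((le_abs_self _).trans (hB _ hq))
  · simp [hq]

/-- Averaged Taylor estimate: the error of replacing means over boxes near `x` by the first order
Taylor polynomial at `x` is controlled by a function of `x` that is bounded in `L²` by the second
derivatives. -/
theorem exists_boxMean_bound {n : ℕ} (hn : n ≠ 0) {f : (Fin d → ℝ) → ℝ} (hf : ContDiff ℝ ∞ f) :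
    ∃ G : (Fin d → ℝ) → ℝ, MemL2 (cube d) G ∧ (∀ x, 0 ≤ G x) ∧
      normL2Sq (cube d) G ≤ 256 ^ d * normL2Sq (cube d) (hessSum f) ∧
      ∀ x ∈ cube d, ∀ m : Fin d → ℝ, Metric.closedBall m (1 / (4 * n)) ⊆ cube d →
        (∀ i, |m i - x i| ≤ 15 / 4 / n) →
        |boxMean n f m - f x - ∑ i, partialDeriv i f x * (m i - x i)| ≤ 16 / n ^ 2 * G x := by
  obtain ⟨B, hB, hle⟩ := hessMean_le (n := n) hf
  have hfin : ∀ x, hessMean n f x ≠ ⊤ := fun x => ((hle x).trans_lt hB.lt_top).ne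
  have hG : MemL2 (cube d) (fun x => (hessMean n f x).toReal) := by
    refine MemLp.of_bound (measurable_hessMean hf).ennreal_toReal.aestronglyMeasurable B.toReal
      (Filter.Eventually.of_forall fun x => ?_)
    rw [Real.norm_of_nonneg ENNReal.toReal_nonneg]
    exact ENNReal.toReal_mono hB (hle x)
  refine ⟨fun x => (hessMean n f x).toReal, hG, fun x => ENNReal.toReal_nonneg, ?_, ?_⟩
  · rw [← ENNReal.ofReal_le_ofReal_iff (mul_nonneg (by positivity) (normL2Sq_nonneg _ _)),
      ← hG.eLpNorm_sq, eLpNorm_two_sq]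
    refine le_trans ?_ (lintegral_sq_hessMean_le hn hf)
    refine (lintegral_mono' Measure.restrict_le_self le_rfl).trans (lintegral_mono fun x => ?_)
    rw [Real.enorm_of_nonneg ENNReal.toReal_nonneg, ENNReal.ofReal_toReal (hfin x)]
  · intro x hx m hm hmx
    have h := ofReal_abs_boxMean_sub_le hn hf hx hm hmx
    rw [← ENNReal.ofReal_toReal (hfin x), ← ENNReal.ofReal_mul (by positivity)] at h
    exact (ENNReal.ofReal_le_ofReal_iff
      (mul_nonneg (by positivity) ENNReal.toReal_nonneg)).1 h

end Taylor

/-! ### The quasi-interpolant and its error -/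

section QuasiInterpolant

variable {d n : ℕ}

/-- The centre of the box that determines the coefficient of `tensorSpline p`. The nodes are moved
towards the centre of the cube by `O(1 / n)`, so that all boxes lie inside the cube. -/
noncomputable def boxCentre (p : Fin d → Fin (n + 2)) : Fin d → ℝ :=
  shrink (1 - 2 / n) fun j => node n (p j)

/-- The spline whose coefficients are means of `f` over small boxes. -/
noncomputable def quasiInterpolant (n : ℕ) (f : (Fin d → ℝ) → ℝ) (x : Fin d → ℝ) : ℝ :=
  ∑ p : Fin d → Fin (n + 2), boxMean n f (boxCentre p) * tensorSpline p x

theorem boxCentre_apply (p : Fin d → Fin (n + 2)) (j : Fin d) :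
    boxCentre p j = (1 - 2 / n) * node n (p j) + 1 / n := by
  rw [boxCentre, shrink_apply]; ring

theorem node_mem (hn : n ≠ 0) (k : Fin (n + 2)) :
    -(1 / n / 2) ≤ node n k ∧ node n k ≤ 1 + (1 / n / 2 : ℝ) := by
  have hn' : (0 : ℝ) < n := by positivity
  have hk : (k : ℝ) ≤ n + 1 := by exact_mod_cast Nat.lt_succ_iff.1 k.2
  have h0 : (0 : ℝ) ≤ k := Nat.cast_nonneg _
  have e : (node n k) * n = (k : ℝ) - 1 / 2 := by rw [node]; field_simp
  have e1 : (1 / n : ℝ) * n = 1 := by field_simp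
  constructor
  · refine le_of_mul_le_mul_right ?_ hn'
    linarith
  · refine le_of_mul_le_mul_right ?_ hn'
    linarith

theorem closedBall_boxCentre_subset (hn : 2 ≤ n) (p : Fin d → Fin (n + 2)) :
    Metric.closedBall (boxCentre p) (1 / (4 * n)) ⊆ cube d := by
  intro z hz j
  have h := (dist_le_pi_dist z (boxCentre p) j).trans hz
  have hn' : (2 : ℝ) ≤ n := by exact_mod_cast hn
  obtain ⟨h1, h2⟩ := node_mem (by omega) (p j)
  rw [boxCentre_apply, Real.dist_eq, abs_le, show 1 / (4 * (n : ℝ)) = 1 / n / 4 by ring,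
    show (2 : ℝ) / n = 2 * (1 / n) by ring] at h
  set a : ℝ := 1 / n
  have ha : 0 < a := by positivity
  have ha2 : a ≤ 1 / 2 := one_div_le_one_div_of_le (by norm_num) hn'
  constructor <;> nlinarith

theorem abs_boxCentre_sub_le (hn : 2 ≤ n) (p : Fin d → Fin (n + 2)) {x : Fin d → ℝ} {j : Fin d}
    (h : |node n (p j) - x j| ≤ 3 / 2 / n) : |boxCentre p j - x j| ≤ 15 / 4 / n := by
  have hn' : (2 : ℝ) ≤ n := by exact_mod_cast hn
  obtain ⟨h1, h2⟩ := node_mem (by omega) (p j)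
  rw [boxCentre_apply, abs_le, show (2 : ℝ) / n = 2 * (1 / n) by ring,
    show (15 / 4 / n : ℝ) = 15 / 4 * (1 / n) by ring]
  rw [abs_le, show (3 / 2 / n : ℝ) = 3 / 2 * (1 / n) by ring] at h
  set a : ℝ := 1 / n
  have ha : 0 < a := by positivity
  have ha2 : a ≤ 1 / 2 := one_div_le_one_div_of_le (by norm_num) hn'
  constructor <;> nlinarith

theorem partialDeriv_quasiInterpolant (f : (Fin d → ℝ) → ℝ) (l : Fin d) (x : Fin d → ℝ) :
    partialDeriv l (quasiInterpolant n f) x =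
      ∑ p : Fin d → Fin (n + 2), boxMean n f (boxCentre p) * tensorSplineDeriv l p x := by
  choose F hF hF' using fun p : Fin d → Fin (n + 2) => hasFDerivAt_tensorSpline p x
  have h : HasFDerivAt (quasiInterpolant n f)
      (∑ p : Fin d → Fin (n + 2), boxMean n f (boxCentre p) • F p) x :=
    HasFDerivAt.fun_sum fun p _ => (hF p).const_mul _
  rw [partialDeriv, h.fderiv, sum_apply]
  exact Finset.sum_congr rfl fun p _ => by rw [smul_apply, hF', smul_eq_mul]

/-- Bounds a combination of box means with weights `N`, supported near `x`: only the zeroth and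
first moments of the weights and the averaged Taylor remainder matter. -/
theorem abs_sum_boxMean_sub_le (hn : 2 ≤ n) {f : (Fin d → ℝ) → ℝ} {x : Fin d → ℝ} {R s S : ℝ}
    (hR : ∀ m : Fin d → ℝ, Metric.closedBall m (1 / (4 * n)) ⊆ cube d →
      (∀ i, |m i - x i| ≤ 15 / 4 / n) →
      |boxMean n f m - f x - ∑ i, partialDeriv i f x * (m i - x i)| ≤ R) (hR0 : 0 ≤ R)
    (N : (Fin d → Fin (n + 2)) → ℝ) (hN : ∀ p, N p ≠ 0 → ∀ j, |node n (p j) - x j| ≤ 3 / 2 / n)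
    (hs : ∑ p, N p = s) (b : Fin d → ℝ) (hb : ∀ i, ∑ p, node n (p i) * N p = b i)
    (hS : ∑ p, |N p| ≤ S) :
    |∑ p, boxMean n f (boxCentre p) * N p - (s * f x + ∑ i, partialDeriv i f x *
      ((1 - 2 / n) * b i + (1 / n - x i) * s))| ≤ S * R := by
  have e : ∑ p, boxMean n f (boxCentre p) * N p - (s * f x + ∑ i, partialDeriv i f x *
      ((1 - 2 / n) * b i + (1 / n - x i) * s)) =
      ∑ p, (boxMean n f (boxCentre p) - f x -
        ∑ i, partialDeriv i f x * (boxCentre p i - x i)) * N p := by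
    simp only [sub_mul, Finset.sum_sub_distrib]
    rw [← Finset.mul_sum, hs]
    have e2 : ∑ p : Fin d → Fin (n + 2), (∑ i, partialDeriv i f x * (boxCentre p i - x i)) * N p =
        ∑ i, partialDeriv i f x * ((1 - 2 / n) * b i + (1 / n - x i) * s) := by
      simp only [Finset.sum_mul]
      rw [Finset.sum_comm]
      refine Finset.sum_congr rfl fun i _ => ?_
      rw [← hb i, ← hs]
      simp only [Finset.mul_sum, ← Finset.sum_add_distrib]
      refine Finset.sum_congr rfl fun p _ => ?_
      rw [boxCentre_apply]
      ring
    rw [e2]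
    simp only [sub_mul]
    ring
  rw [e]
  refine (Finset.abs_sum_le_sum_abs _ _).trans ?_
  calc _ ≤ ∑ p, R * |N p| := by
        refine Finset.sum_le_sum fun p _ => ?_
        rw [abs_mul]
        by_cases hp : N p = 0
        · simp [hp]
        · exact mul_le_mul_of_nonneg_right (hR _ (closedBall_boxCentre_subset hn p)
            fun i => abs_boxCentre_sub_le hn p (hN p hp i)) (abs_nonneg _)
    _ ≤ S * R := by rw [← Finset.mul_sum, mul_comm]; exact mul_le_mul_of_nonneg_right hS hR0

/-- Pointwise error bounds. -/
theorem abs_quasiInterpolant_sub_le (hn : 2 ≤ n) {f : (Fin d → ℝ) → ℝ} {x : Fin d → ℝ}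
    (hx : x ∈ cube d) {G : ℝ} (hG0 : 0 ≤ G)
    (hG : ∀ m : Fin d → ℝ, Metric.closedBall m (1 / (4 * n)) ⊆ cube d →
      (∀ i, |m i - x i| ≤ 15 / 4 / n) →
      |boxMean n f m - f x - ∑ i, partialDeriv i f x * (m i - x i)| ≤ 16 / n ^ 2 * G) :
    |f x - quasiInterpolant n f x| ≤ 32 / n * G + 2 / n * ∑ i, |partialDeriv i f x| ∧
    ∀ l, |partialDeriv l f x - partialDeriv l (quasiInterpolant n f) x| ≤
      32 / n * G + 2 / n * |partialDeriv l f x| := by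
  have hn0 : n ≠ 0 := by omega
  have hn' : (2 : ℝ) ≤ n := by exact_mod_cast hn
  have hnn : (n : ℝ) ≠ 0 := by positivity
  have hR0 : 0 ≤ 16 / (n : ℝ) ^ 2 * G := by positivity
  constructor
  · have h := abs_sum_boxMean_sub_le hn hG hR0 (fun p => tensorSpline p x)
      (fun p hp j => abs_node_sub_le_of_tensorSpline hn0 (Or.inl hp) j)
      (sum_tensorSpline hx) x (sum_node_mul_tensorSpline hn0 hx)
      (S := 1)
      (by simp only [abs_of_nonneg (tensorSpline_nonneg _ x), sum_tensorSpline hx, le_refl])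
    have h2 : |∑ i, partialDeriv i f x * ((1 - 2 / n) * x i + (1 / n - x i) * 1)| ≤
        2 / n * ∑ i, |partialDeriv i f x| := by
      rw [Finset.mul_sum]
      refine (Finset.abs_sum_le_sum_abs _ _).trans (Finset.sum_le_sum fun i _ => ?_)
      rw [abs_mul, mul_comm]
      refine mul_le_mul_of_nonneg_right ?_ (abs_nonneg _)
      rw [show (1 - 2 / (n : ℝ)) * x i + (1 / n - x i) * 1 = 2 / n * (1 / 2 - x i) by ring, abs_mul,
        abs_of_nonneg (by positivity)]
      refine mul_le_of_le_one_right (by positivity) (abs_le.2 ⟨?_, ?_⟩) <;>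
        linarith [(hx i).1, (hx i).2]
    have h3 : 1 * (16 / (n : ℝ) ^ 2 * G) ≤ 32 / n * G := by
      rw [one_mul]
      refine mul_le_mul_of_nonneg_right ?_ hG0
      rw [div_le_div_iff₀ (by positivity) (by positivity)]
      nlinarith
    rw [quasiInterpolant]
    have h' := abs_le.1 h
    have h2' := abs_le.1 h2
    rw [abs_le]
    constructor <;> linarith [h'.1, h'.2, h2'.1, h2'.2]
  · intro l
    have h := abs_sum_boxMean_sub_le hn hG hR0 (fun p => tensorSplineDeriv l p x)
      (fun p hp j => abs_node_sub_le_of_tensorSpline hn0 (Or.inr ⟨l, hp⟩) j)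
      (sum_tensorSplineDeriv hx l) (fun r => if r = l then 1 else 0)
      (sum_node_mul_tensorSplineDeriv hn0 hx l) (sum_abs_tensorSplineDeriv_le hx l)
    rw [← partialDeriv_quasiInterpolant] at h
    simp only [mul_zero, zero_mul, add_zero, zero_add, mul_ite, mul_one, Finset.sum_ite_eq',
      Finset.mem_univ, if_true] at h
    have e : 2 * (n : ℝ) * (16 / n ^ 2 * G) = 32 / n * G := by field_simp; ring
    rw [e] at h
    have e2 : partialDeriv l f x - partialDeriv l (quasiInterpolant n f) x =
        -(partialDeriv l (quasiInterpolant n f) x - partialDeriv l f x * (1 - 2 / n)) +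
          2 / n * partialDeriv l f x := by ring
    rw [e2]
    refine (abs_add_le _ _).trans ?_
    rw [abs_neg, abs_mul (2 / (n : ℝ)), abs_of_nonneg (show 0 ≤ 2 / (n : ℝ) by positivity)]
    exact add_le_add_left h _

theorem partialDeriv_comm {f : (Fin d → ℝ) → ℝ} (hf : ContDiff ℝ ∞ f) (i j : Fin d)
    (x : Fin d → ℝ) :
    partialDeriv i (partialDeriv j f) x = partialDeriv j (partialDeriv i f) x := by
  have hs : IsSymmSndFDerivAt ℝ f x := hf.contDiffAt.isSymmSndFDerivAt
    (by simpa using WithTop.coe_le_coe.2 (le_top : (2 : ℕ∞) ≤ ⊤))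
  have hd : DifferentiableAt ℝ (fderiv ℝ f) x :=
    (hf.fderiv_right (m := ∞) (by simp)).differentiable (by simp) x
  have e : ∀ i j, partialDeriv i (partialDeriv j f) x =
      fderiv ℝ (fderiv ℝ f) x (Pi.single i 1) (Pi.single j 1) := by
    intro i j
    have := hd.hasFDerivAt.clm_apply (hasFDerivAt_const (Pi.single j (1 : ℝ)) x)
    rw [partialDeriv]
    erw [this.fderiv]
    simp
  rw [e, e]
  exact hs _ _

theorem normL2Sq_hessSum_le {f : (Fin d → ℝ) → ℝ} (hf : ContDiff ℝ ∞ f) :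
    normL2Sq (cube d) (hessSum f) ≤ 2 * d ^ 2 * ∑ j, ∑ i ∈ Finset.univ.filter (fun i => i ≤ j),
      normL2Sq (cube d) (partialDeriv i (partialDeriv j f)) := by
  have hm : ∀ i j, MemL2 (cube d) (fun x => |partialDeriv i (partialDeriv j f) x|) := fun i j =>
    MemL2.of_continuous ((hf.partialDeriv_infty j).partialDeriv_infty i).continuous.abs
  let a : Fin d → Fin d → ℝ := fun i j => normL2Sq (cube d) (partialDeriv i (partialDeriv j f))
  have ha0 : ∀ i j, 0 ≤ a i j := fun i j => normL2Sq_nonneg _ _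
  have habs : ∀ i j, normL2Sq (cube d) (fun x => |partialDeriv i (partialDeriv j f) x|) = a i j :=
    fun i j => by simp only [normL2Sq, sq_abs, a]
  have hsymm : ∀ i j, a i j = a j i := fun i j =>
    congrArg (normL2Sq (cube d)) (funext fun x => partialDeriv_comm hf i j x)
  have h1 : normL2Sq (cube d) (hessSum f) ≤ d * ∑ i, (d * ∑ j, a i j) := by
    refine (normL2Sq_sum_le fun i _ => memL2_sum fun j _ => hm i j).trans ?_
    rw [Finset.card_univ, Fintype.card_fin]
    gcongr with i
    refine (normL2Sq_sum_le fun j _ => hm i j).trans_eq ?_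
    rw [Finset.card_univ, Fintype.card_fin, Finset.sum_congr rfl fun j _ => habs i j]
  have h2 : ∑ i, ∑ j, a i j ≤ 2 * ∑ j, ∑ i ∈ Finset.univ.filter (fun i => i ≤ j), a i j := by
    have e1 : ∀ i j : Fin d, a i j ≤ (if i ≤ j then a i j else 0) + if j ≤ i then a j i else 0 := by
      intro i j
      rcases le_total i j with h | h
      · rw [if_pos h]
        exact le_add_of_nonneg_right (by split_ifs <;> simp [ha0])
      · rw [if_pos h, hsymm]
        exact le_add_of_nonneg_left (by split_ifs <;> simp [ha0])
    refine (Finset.sum_le_sum fun i _ => Finset.sum_le_sum fun j _ => e1 i j).trans_eq ?_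
    simp only [Finset.sum_add_distrib, Finset.sum_filter]
    rw [Finset.sum_comm, two_mul]
  calc _ ≤ _ := h1
    _ = d ^ 2 * ∑ i, ∑ j, a i j := by rw [← Finset.mul_sum]; ring
    _ ≤ d ^ 2 * (2 * ∑ j, ∑ i ∈ Finset.univ.filter (fun i => i ≤ j), a i j) := by gcongr
    _ = _ := by ring

/-- The constant in the error bound for the quasi-interpolant. -/
noncomputable def splineConst (d : ℕ) : ℝ :=
  2048 * (d + 1) * (256 ^ d * (2 * d ^ 2)) + 8 * (d + 1)

theorem splineConst_pos (d : ℕ) : 0 < splineConst d := by unfold splineConst; positivity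

/-- The quasi-interpolant of a smooth function converges in `H¹` with first order in the mesh
width, with a bound by the `L²` norms of the first and second derivatives. -/
theorem sq_normH1_quasiInterpolant_sub_le (hn : 2 ≤ n) {f : (Fin d → ℝ) → ℝ} (hf : ContDiff ℝ ∞ f) :
    normL2Sq (cube d) (fun x => f x - quasiInterpolant n f x) +
      ∑ l, normL2Sq (cube d)
        (fun x => partialDeriv l f x - partialDeriv l (quasiInterpolant n f) x) ≤
    splineConst d / n ^ 2 * (∑ i, normL2Sq (cube d) (partialDeriv i f) +
      ∑ j, ∑ i ∈ Finset.univ.filter (fun i => i ≤ j),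
        normL2Sq (cube d) (partialDeriv i (partialDeriv j f))) := by
  have hn0 : n ≠ 0 := by omega
  have hnn : (0 : ℝ) < n := by positivity
  obtain ⟨G, hGm, hG0, hGle, hG⟩ := exists_boxMean_bound hn0 hf
  have hpt := fun x (hx : x ∈ cube d) =>
    abs_quasiInterpolant_sub_le hn hx (hG0 x) (hG x hx)
  have hGn : MemL2 (cube d) (fun x => 32 / n * G x) := MemLp.const_mul hGm _
  have hpm : ∀ i, MemL2 (cube d) (fun x => |partialDeriv i f x|) := fun i =>
    MemL2.of_continuous (hf.partialDeriv_infty i).continuous.abs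
  have habs : ∀ i, normL2Sq (cube d) (fun x => |partialDeriv i f x|) =
      normL2Sq (cube d) (partialDeriv i f) := fun i => by simp only [normL2Sq, sq_abs]
  -- both kinds of errors have the same form
  have key : ∀ {e g : (Fin d → ℝ) → ℝ}, MemL2 (cube d) g →
      (∀ x ∈ cube d, |e x| ≤ 32 / n * G x + 2 / n * g x) →
      normL2Sq (cube d) e ≤ 2048 / n ^ 2 * normL2Sq (cube d) G +
        8 / n ^ 2 * normL2Sq (cube d) g := by
    intro e g hg h
    have hgn : MemL2 (cube d) (fun x => 2 / n * g x) := MemLp.const_mul hg _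
    refine (MemL2.normL2Sq_mono (measurableSet_cube d) (hGn.add hgn) fun x hx => ?_).trans
      ((MemL2.normL2Sq_add_le hGn hgn).trans_eq ?_)
    · exact (h x hx).trans (le_abs_self _)
    · rw [normL2Sq_const_mul, normL2Sq_const_mul]
      ring
  have h0 := key (memL2_sum fun i (_ : i ∈ Finset.univ) => hpm i)
    fun x hx => (hpt x hx).1
  have h1 := fun l => key (hpm l) fun x hx => (hpt x hx).2 l
  have hsum := normL2Sq_sum_le fun i (_ : i ∈ (Finset.univ : Finset (Fin d))) => hpm i
  rw [Finset.card_univ, Fintype.card_fin, Finset.sum_congr rfl fun i _ => habs i] at hsum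
  set A := ∑ i, normL2Sq (cube d) (partialDeriv i f)
  set H := ∑ j, ∑ i ∈ Finset.univ.filter (fun i => i ≤ j),
        normL2Sq (cube d) (partialDeriv i (partialDeriv j f))
  have hA : 0 ≤ A := Finset.sum_nonneg fun _ _ => normL2Sq_nonneg _ _
  have hH : 0 ≤ H := Finset.sum_nonneg fun _ _ => Finset.sum_nonneg fun _ _ => normL2Sq_nonneg _ _
  have hGH : normL2Sq (cube d) G ≤ 256 ^ d * (2 * d ^ 2) * H := by
    refine hGle.trans ?_
    rw [mul_assoc]
    gcongr
    exact normL2Sq_hessSum_le hf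
  calc _ ≤ (2048 / (n : ℝ) ^ 2 * normL2Sq (cube d) G + 8 / n ^ 2 * (d * A)) +
        ∑ l, (2048 / (n : ℝ) ^ 2 * normL2Sq (cube d) G +
          8 / n ^ 2 * normL2Sq (cube d) (partialDeriv l f)) := by
        refine add_le_add (h0.trans (by gcongr)) (Finset.sum_le_sum fun l _ => ?_)
        rw [← habs l]
        exact h1 l
    _ = (2048 * (d + 1) * normL2Sq (cube d) G + 8 * (d + 1) * A) / n ^ 2 := by
        rw [Finset.sum_add_distrib, Finset.sum_const, Finset.card_univ, Fintype.card_fin,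
          nsmul_eq_mul, ← Finset.mul_sum]
        ring
    _ ≤ (2048 * (d + 1) * (256 ^ d * (2 * d ^ 2) * H) + 8 * (d + 1) * A) / n ^ 2 := by gcongr
    _ ≤ (splineConst d * (A + H)) / n ^ 2 := by
        gcongr
        have h3 : 0 ≤ 2048 * ((d : ℝ) + 1) * (256 ^ d * (2 * d ^ 2)) * A := by positivity
        have h4 : 0 ≤ 8 * ((d : ℝ) + 1) * H := by positivity
        rw [splineConst]
        linarith
    _ = _ := by ring

end QuasiInterpolant

/-! ### Approximation of `H²` functions by networks -/

/-- The quasi-interpolant of a smooth approximation of `u` is a network function close to `u`. -/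
theorem MemH2.exists_isNet {d : ℕ} (hd : 1 ≤ d) {u : (Fin d → ℝ) → ℝ} (hu : MemH2 (cube d) u)
    {n : ℕ} (hn : 2 ≤ n) {η : ℝ} (hη : 0 < η) :
    ∃ v : (Fin d → ℝ) → ℝ, IsNet (Nat.clog 2 d + 2) (4 * d * (n + 2) ^ d) v ∧
      normH1 (cube d) (fun x => u x - v x) ^ 2 ≤
        η + 2 * (splineConst d * 2 ^ d) * (normH2 (cube d) u / n) ^ 2 := by
  obtain ⟨f, hf, hfu, hf1, hf2⟩ := hu.exists_contDiff (half_pos hη)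
  have hnet := isNet_sum_tensorSpline (n := n) (fun p => boxMean n f (boxCentre p)) hd
  change IsNet _ _ (quasiInterpolant n f) at hnet
  have hQ := hnet.contDiff
  have hfQ := sq_normH1_quasiInterpolant_sub_le hn hf
  refine ⟨_, hnet, ?_⟩
  rw [(hu.sub_contDiff hQ).2]
  have hf1' : ContDiff ℝ 1 f := hf.of_le (by simp)
  have hL0 : normL2Sq (cube d) (fun x => u x - quasiInterpolant n f x) ≤
      2 * normL2Sq (cube d) (fun x => u x - f x) +
        2 * normL2Sq (cube d) (fun x => f x - quasiInterpolant n f x) := by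
    have h := MemL2.normL2Sq_add_le (hu.1.sub (MemL2.of_continuous hf.continuous))
      ((MemL2.of_continuous hf.continuous).sub (MemL2.of_continuous hQ.continuous))
    exact (congrArg (normL2Sq (cube d)) (funext fun x => by simp)).trans_le h
  have hL1 : ∀ i, normL2Sq (cube d)
      (fun x => weakPartial (cube d) i u x - partialDeriv i (quasiInterpolant n f) x) ≤
      2 * normL2Sq (cube d) (fun x => weakPartial (cube d) i u x - partialDeriv i f x) +
        2 * normL2Sq (cube d)
          (fun x => partialDeriv i f x - partialDeriv i (quasiInterpolant n f) x) := by
    intro i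
    have hc := hf1'.continuous_partialDeriv i
    have h := MemL2.normL2Sq_add_le
      ((hu.hasWeakPartial (isOpen_cube d) i).2.sub (MemL2.of_continuous hc))
      ((MemL2.of_continuous hc).sub (MemL2.of_continuous (hQ.continuous_partialDeriv i)))
    exact (congrArg (normL2Sq (cube d)) (funext fun x => by simp)).trans_le h
  have hbound : ∑ i, normL2Sq (cube d) (partialDeriv i f) +
      ∑ j, ∑ i ∈ Finset.univ.filter (fun i => i ≤ j),
        normL2Sq (cube d) (partialDeriv i (partialDeriv j f)) ≤ 2 ^ d * normH2 (cube d) u ^ 2 := by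
    rw [sq_normH2, mul_add, mul_add, Finset.mul_sum, Finset.mul_sum]
    refine add_le_add ?_ (Finset.sum_le_sum fun j _ => ?_)
    · refine (Finset.sum_le_sum fun i _ => hf1 i).trans (le_add_of_nonneg_left ?_)
      exact mul_nonneg (by positivity) (normL2Sq_nonneg _ _)
    · rw [Finset.mul_sum]
      exact Finset.sum_le_sum fun i _ => hf2 i j
  have hC := splineConst_pos d
  calc _ ≤ 2 * (normL2Sq (cube d) (fun x => u x - f x) + ∑ i, normL2Sq (cube d)
        (fun x => weakPartial (cube d) i u x - partialDeriv i f x)) +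
      2 * (normL2Sq (cube d) (fun x => f x - quasiInterpolant n f x) + ∑ l, normL2Sq (cube d)
        (fun x => partialDeriv l f x - partialDeriv l (quasiInterpolant n f) x)) := by
        refine (add_le_add hL0 (Finset.sum_le_sum fun i _ => hL1 i)).trans_eq ?_
        rw [Finset.sum_add_distrib, ← Finset.mul_sum, ← Finset.mul_sum]
        ring
    _ ≤ 2 * (η / 2) + 2 * (splineConst d / n ^ 2 * (2 ^ d * normH2 (cube d) u ^ 2)) := by
        gcongr
        exact hfQ.trans (by gcongr)
    _ = _ := by ring

/-- A bound for the distance of `u` to a member of a class is a bound for the approximation error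
of the class. -/
theorem approxError_le {d D W : ℕ} {B : ℝ} (w u : (Fin d → ℝ) → ℝ) {v : (Fin d → ℝ) → ℝ}
    (hv : v ∈ reluSqClass d D W B) :
    approxError d D W B w u ≤ max (normLinf (cube d) w) 1 / 2 *
      normH1 (cube d) (fun x => u x - v x) ^ 2 := by
  have : BddBelow (Set.range fun v : reluSqClass d D W B =>
      normH1 (cube d) (fun x => u x - v.1 x) ^ 2) := by
    refine ⟨0, ?_⟩
    rintro _ ⟨v, rfl⟩
    exact sq_nonneg _
  exact mul_le_mul_of_nonneg_left (ciInf_le this ⟨v, hv⟩)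
    (div_nonneg (le_max_of_le_right zero_le_one) zero_le_two)

end DeepRitz

theorem theorem1 (d : ℕ) (hd : 1 ≤ d) :
    ∃ C : ℝ, 0 < C ∧
      ∀ (c₂ : ℝ) (u : (Fin d → ℝ) → ℝ),
        DeepRitz.MemH2 (DeepRitz.cube d) u → DeepRitz.normH2 (DeepRitz.cube d) u ≤ c₂ →
        ∀ ε : ℝ, 0 < ε →
          ∃ (D W : ℕ) (B : ℝ), ∃ v ∈ DeepRitz.reluSqClass d D W B,
            (D : ℤ) ≤ ⌈Real.logb 2 (d : ℝ)⌉ + 3 ∧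
            (W : ℤ) ≤ 4 * (d : ℤ) * (max 1 ⌈C * c₂ / ε - 4⌉) ^ d ∧
            DeepRitz.MemH1 (DeepRitz.cube d) (fun x => u x - v x) ∧
            DeepRitz.normH1 (DeepRitz.cube d) (fun x => u x - v x) ≤ ε ∧
            ∀ w : (Fin d → ℝ) → ℝ,
              MeasureTheory.MemLp w ⊤ (MeasureTheory.volume.restrict (DeepRitz.cube d)) →
              DeepRitz.approxError d D W B w u ≤
                  max (DeepRitz.normLinf (DeepRitz.cube d) w) 1 / 2 *
                    DeepRitz.normH1 (DeepRitz.cube d) (fun x => u x - v x) ^ 2 ∧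
                max (DeepRitz.normLinf (DeepRitz.cube d) w) 1 / 2 *
                    DeepRitz.normH1 (DeepRitz.cube d) (fun x => u x - v x) ^ 2 ≤
                  max (DeepRitz.normLinf (DeepRitz.cube d) w) 1 / 2 * ε ^ 2 := by
  let K : ℝ := DeepRitz.splineConst d * 2 ^ d
  have hK : 0 < K := mul_pos (DeepRitz.splineConst_pos d) (by positivity)
  -- `64 K ≤ C ^ 2` makes the spline error at most `ε / √2`; `7 ≤ C` serves the zero network.
  refine ⟨64 * K + 7, by positivity, fun c₂ u hu hc ε hε => ?_⟩
  set C : ℝ := 64 * K + 7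
  have hlog : ⌈Real.logb 2 (d : ℝ)⌉ = (Nat.clog 2 d : ℤ) := by
    have := Real.ceil_logb_natCast (b := 2) (r := (d : ℝ)) (Nat.cast_nonneg d)
    rw [Int.clog_natCast] at this
    exact_mod_cast this
  have hc0 : 0 ≤ c₂ := (Real.sqrt_nonneg _).trans hc
  -- it suffices to find a network function of the right size that is close to `u`
  suffices h : ∃ (L N : ℕ) (v : (Fin d → ℝ) → ℝ), DeepRitz.IsNet L (4 * d * N ^ d) v ∧
      L ≤ Nat.clog 2 d + 3 ∧ (N : ℤ) ≤ max 1 ⌈C * c₂ / ε - 4⌉ ∧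
      DeepRitz.normH1 (DeepRitz.cube d) (fun x => u x - v x) ≤ ε by
    obtain ⟨L, N, v, hv, hL, hN, hve⟩ := h
    obtain ⟨W, hW, B, hB⟩ := hv.exists_mem_reluSqClass
    refine ⟨L, W, B, v, hB, ?_, ?_, (hu.sub_contDiff hv.contDiff).1, hve, fun w _ =>
      ⟨DeepRitz.approxError_le w u hB, ?_⟩⟩
    · rw [hlog]
      exact_mod_cast hL
    · calc (W : ℤ) ≤ 4 * d * (N : ℤ) ^ d := by exact_mod_cast hW
        _ ≤ _ := by gcongr
    · have := DeepRitz.normH1_nonneg (DeepRitz.cube d) (fun x => u x - v x)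
      gcongr
  rcases lt_or_ge ⌈C * c₂ / ε - 4⌉ 4 with hM | hM
  · -- here `c₂ ≤ ε`, and the zero network suffices
    have h1 : C * c₂ / ε - 4 ≤ 3 := by
      have : ⌈C * c₂ / ε - 4⌉ ≤ 3 := by omega
      exact_mod_cast Int.ceil_le.1 this
    have h2 : C * c₂ ≤ 7 * ε := (div_le_iff₀ hε).1 (by linarith)
    have h3 : c₂ ≤ ε := by
      have : 0 ≤ K * c₂ := by positivity
      have h4 : C * c₂ = 64 * (K * c₂) + 7 * c₂ := by ring
      linarith
    have hz := (DeepRitz.isNet_affine (n := d) 0 0).mono (W' := 4 * d * 1 ^ d)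
      (by rw [one_pow]; omega)
    refine ⟨1, 1, _, hz, by omega, by simp, ?_⟩
    simpa using (DeepRitz.normH1_le_normH2 _ u).trans (hc.trans h3)
  · obtain ⟨M, hMeq⟩ := Int.eq_ofNat_of_zero_le (show 0 ≤ ⌈C * c₂ / ε - 4⌉ by omega)
    obtain ⟨n, rfl⟩ : ∃ n, M = n + 2 := ⟨M - 2, by omega⟩
    have hn : 2 ≤ n := by omega
    have hn' : (2 : ℝ) ≤ n := by exact_mod_cast hn
    obtain ⟨v, hv, hve⟩ := hu.exists_isNet hd hn (η := ε ^ 2 / 2) (by positivity)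
    refine ⟨_, n + 2, v, hv, by omega, by rw [hMeq]; exact le_max_right _ _, ?_⟩
    have h1 : C * c₂ / ε - 4 ≤ n + 2 := by
      have := Int.le_ceil (C * c₂ / ε - 4)
      rw [hMeq] at this
      exact_mod_cast this
    have h2 : C * c₂ ≤ 4 * n * ε := (div_le_iff₀ hε).1 (by linarith)
    have h3 : C * (DeepRitz.normH2 (DeepRitz.cube d) u / n) ≤ 4 * ε := by
      rw [← mul_div_assoc, div_le_iff₀ (by positivity)]
      have : C * DeepRitz.normH2 (DeepRitz.cube d) u ≤ C * c₂ := by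
        have : 0 < C := by positivity
        gcongr
      linarith
    set q := DeepRitz.normH2 (DeepRitz.cube d) u / n
    have hq : 0 ≤ q := div_nonneg (Real.sqrt_nonneg _) (by positivity)
    have h4 : 64 * K * q ^ 2 ≤ 16 * ε ^ 2 := by
      have hCK : 64 * K ≤ C ^ 2 := by
        have : C ^ 2 = C * (64 * K + 7) := by ring
        nlinarith
      calc 64 * K * q ^ 2 ≤ C ^ 2 * q ^ 2 := by gcongr
        _ = (C * q) ^ 2 := by ring
        _ ≤ (4 * ε) ^ 2 := by
          have : 0 < C := by positivity
          gcongr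
        _ = _ := by ring
    refine le_of_sq_le_sq ?_ hε.le
    refine hve.trans ?_
    change ε ^ 2 / 2 + 2 * K * q ^ 2 ≤ ε ^ 2
    linarith
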